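/- Let $m=(m_k)_{k\ge 0}$ be a bounded sequence of integers $m_k\ge 2$, let $G_m=\prod_{k}\mathbb Z_{m_k}$ be the corresponding bounded Vilenkin group with normalized Haar measure $\mu$, and let $\mathcal F_n$ be the $\sigma$-algebra generated by the sets $I_n(x)=\{y: y_0=x_0,\dots,y_{n-1}=x_{n-1}\}$, $x\in G_m$. Put $M_0=1$, $M_{k+1}=m_kM_k$, write $n=\sum_k n_kM_k$ with $0\le n_k<m_k$, and let $\psi_n(x)=\prod_k \exp(2\pi i\,n_kx_k/m_k)$ be the Vilenkin functions. For $0<p\le 1$ let $H_p(G_m)$ be the space of the (complex) martingales $f=(f_n)$ with respect to $(\mathcal F_n)$ with $\|f\|_{H_p}:=\|\sup_n|f_n|\,\|_{L_p}<\infty$; for such $f$ put $\widehat f(i)=\lim_{k\to\infty}\int f_k\overline{\psi_i}\,d\mu$ and $S_nf=\sum_{i=0}^{n-1}\widehat f(i)\psi_i$ (so $S_0f=0$). Let $\|g\|_{L_p}=(\int|g|^p\,d\mu)^{1/p}$, $\|g\|_{L_{p,\infty}}=\sup_{\lambda>0}\lambda\,\mu(|g|>\lambda)^{1/p}$, and let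 $[p]$ be the integer part of $p$. (a) Let $0<p\le 1$. The weighted maximal operator $$\widetilde S_p^*f=\sup_{n\ge 0}\frac{|S_nf|}{(n+1)^{1/p-1}\log^{[p]}(n+1)}$$ (where the term $n=0$ is taken to be $0$) is bounded from $H_p(G_m)$ to $L_p(G_m)$: there is a constant $C$, depending only on $p$ and $m$, such that $\|\widetilde S_p^*f\|_{L_p}\le C\|f\|_{H_p}$ for all $f\in H_p(G_m)$. (b) Let $0<p\le 1$ and let $\varphi:\{1,2,\dots\}\to[1,\infty)$ be a nondecreasing function with $$\limsup_{n\to\infty}\frac{(n+1)^{1/p-1}\log^{[p]}(n+1)}{\varphi(n)}=+\infty .$$ If $0<p<1$, then there is a martingale $f\in H_p(G_m)$ such that $$\sup_{n\ge 1}\left\|\frac{S_nf}{\varphi(n)}\right\|_{L_{p,\infty}}=\infty .$$ If $p=1$, then there is a martingale $f\in H_1(G_m)$ such that $$\sup_{n\ge 1}\left\|\frac{S_nf}{\varphi(n)}\right\|_{L_1}=\infty .$$ -/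

import Mathlib

open MeasureTheory Filter
open scoped ENNReal NNReal

noncomputable section

namespace Vilenkin

/-- The Vilenkin group `G_m`: the complete direct product of the cyclic groups `Z_{m_k}`. Its
measurable structure is the product one, which is the Borel structure of the product topology. -/
abbrev Group (m : ℕ → ℕ) : Type := ∀ k, ZMod (m k)

/-- The measure `μ_k` on `Z_{m_k}` giving mass `1 / m_k` to every point. -/
def coordMeasure (m : ℕ → ℕ) (k : ℕ) : Measure (ZMod (m k)) :=
  (m k : ℝ≥0∞)⁻¹ • Measure.count

/-- The normalized Haar measure of `G_m`: the product of the measures `μ_k`. -/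
def haar (m : ℕ → ℕ) : Measure (Group m) := Measure.infinitePi (coordMeasure m)

/-- The interval `I_n(x)`: the points that agree with `x` in the coordinates `0, …, n - 1`. -/
def interval (m : ℕ → ℕ) (n : ℕ) (x : Group m) : Set (Group m) :=
  {y | ∀ k < n, y k = x k}

/-- The `σ`-algebra generated by the intervals `I_n(x)`, `x ∈ G_m`. -/
abbrev sigmaAlg (m : ℕ → ℕ) (n : ℕ) : MeasurableSpace (Group m) :=
  MeasurableSpace.generateFrom (Set.range (interval m n))

theorem measurableSet_interval (m : ℕ → ℕ) (n : ℕ) (x : Group m) :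
    MeasurableSet (interval m n x) := by
  have h : interval m n x = ⋂ k : ℕ, ⋂ _ : k < n, (fun y : Group m => y k) ⁻¹' {x k} := by
    ext y
    simp [interval]
  rw [h]
  refine MeasurableSet.iInter fun k => MeasurableSet.iInter fun _ => ?_
  exact measurable_pi_apply k (MeasurableSpace.measurableSet_top)

theorem sigmaAlg_le_succ (m : ℕ → ℕ) (n : ℕ) : sigmaAlg m n ≤ sigmaAlg m (n + 1) := by
  refine MeasurableSpace.generateFrom_le ?_
  rintro _ ⟨x, rfl⟩
  have h : interval m n x = ⋃ j : ZMod (m n), interval m (n + 1) (Function.update x n j) := by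
    ext y
    simp only [interval, Set.mem_ofPred_eq, Set.mem_iUnion]
    constructor
    · intro hy
      refine ⟨y n, fun k hk => ?_⟩
      rcases Nat.lt_succ_iff_lt_or_eq.mp hk with hk | rfl
      · rw [Function.update_of_ne hk.ne]
        exact hy k hk
      · simp
    · rintro ⟨j, hj⟩ k hk
      have := hj k (by omega)
      rwa [Function.update_of_ne hk.ne] at this
  rw [h]
  have : Countable (ZMod (m n)) := by
    cases m n with
    | zero => exact inferInstanceAs (Countable ℤ)
    | succ l => exact inferInstanceAs (Countable (Fin (l + 1)))
  exact MeasurableSet.iUnion fun j => MeasurableSpace.measurableSet_generateFrom ⟨_, rfl⟩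

/-- The filtration of the `σ`-algebras generated by the intervals of rank `n`. -/
def filtration (m : ℕ → ℕ) :
    Filtration ℕ (inferInstance : MeasurableSpace (Group m)) where
  seq := sigmaAlg m
  mono' := monotone_nat_of_le_succ (sigmaAlg_le_succ m)
  le' n := by
    refine MeasurableSpace.generateFrom_le ?_
    rintro _ ⟨x, rfl⟩
    exact measurableSet_interval m n x

/-- The generalized powers `M_0 = 1`, `M_{k+1} = m_k M_k`. -/
def bigM (m : ℕ → ℕ) : ℕ → ℕ
  | 0 => 1
  | k + 1 => m k * bigM m k

/-- The digit `n_k ∈ {0, …, m_k - 1}` of `n = ∑ n_k M_k`. -/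
def digit (m : ℕ → ℕ) (n k : ℕ) : ℕ := n / bigM m k % m k

/-- The generalized Rademacher function `r_k(x) = exp (2πi x_k / m_k)`. -/
def rademacher (m : ℕ → ℕ) (k : ℕ) (x : Group m) : ℂ :=
  Complex.exp (2 * Real.pi * Complex.I * ((x k).val : ℂ) / (m k : ℂ))

/-- The Vilenkin function `ψ_n = ∏_k r_k ^ {n_k}`. The factors with `k ≥ n` are equal to `1`, since
`M_k ≥ 2 ^ k > n` for them if all `m_k ≥ 2`. -/
def psi (m : ℕ → ℕ) (n : ℕ) (x : Group m) : ℂ :=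
  ∏ k ∈ Finset.range n, rademacher m k x ^ digit m n k

/-- The Vilenkin–Fourier coefficient `lim_k ∫ f_k conj(ψ_i) dμ` of a martingale `f = (f_k)`
(for a martingale the sequence of integrals is eventually constant, so that the limit exists). -/
def coeff (m : ℕ → ℕ) (f : ℕ → Group m → ℂ) (i : ℕ) : ℂ :=
  limUnder atTop fun k : ℕ => ∫ x, f k x * (starRingEnd ℂ) (psi m i x) ∂(haar m)

/-- The partial sum `S_n f = ∑_{i < n} f^(i) ψ_i`. -/
def partialSum (m : ℕ → ℕ) (f : ℕ → Group m → ℂ) (n : ℕ) (x : Group m) : ℂ :=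
  ∑ i ∈ Finset.range n, coeff m f i * psi m i x

/-- The maximal function `f^* = sup_n |f_n|`. -/
def maximalFunction (m : ℕ → ℕ) (f : ℕ → Group m → ℂ) (x : Group m) : ℝ≥0∞ :=
  ⨆ n, ‖f n x‖ₑ

/-- The Hardy quasinorm `‖f‖_{H_p} = ‖f^*‖_p`. -/
def hardyNorm (m : ℕ → ℕ) (p : ℝ) (f : ℕ → Group m → ℂ) : ℝ≥0∞ :=
  eLpNorm (maximalFunction m f) (ENNReal.ofReal p) (haar m)

/-- The martingale Hardy space `H_p(G_m)`. -/
def hardySpace (m : ℕ → ℕ) (p : ℝ) : Set (ℕ → Group m → ℂ) :=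
  {f | Martingale f (filtration m) (haar m) ∧ hardyNorm m p f < ∞}

/-- The weight `(n + 1) ^ {1/p - 1} log ^ {[p]} (n + 1)`. -/
def weight (p : ℝ) (n : ℕ) : ℝ :=
  ((n : ℝ) + 1) ^ (1 / p - 1) * Real.log ((n : ℝ) + 1) ^ ⌊p⌋₊

/-- The weighted maximal operator `sup_n |S_n f| / weight p n`. The term `n = 0` is `0`, as
`S_0 f = 0` and `0 / 0 = 0`. -/
def weightedMaximal (m : ℕ → ℕ) (p : ℝ) (f : ℕ → Group m → ℂ) (x : Group m) : ℝ≥0∞ :=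
  ⨆ n : ℕ, ‖partialSum m f n x‖ₑ / ENNReal.ofReal (weight p n)

/-- The quasinorm `sup_{t > 0} t μ(|g| > t) ^ {1/p}` of `L_{p,∞}(G_m)`. -/
def weakLpNorm (m : ℕ → ℕ) (p : ℝ) (g : Group m → ℂ) : ℝ≥0∞ :=
  ⨆ (t : ℝ≥0) (_ : 0 < t), (t : ℝ≥0∞) * haar m {x | (t : ℝ≥0∞) < ‖g x‖ₑ} ^ (1 / p)

end Vilenkin

end

noncomputable section

namespace Vilenkin

variable {m : ℕ → ℕ}

/-! ### Generalized powers and digits -/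

/-! Write E_j for the average over intervals of rank j. (a) Splitting the frequencies below n along
the digits of n gives blocks of M_j consecutive characters, and the part of a function carried by
one block is a modulated E_j. Hence, for M_K ≤ n < M_{K+1}, |S_n f| ≤ R ∑_{j ≤ K} E_j|f_{K+1}|,
where R bounds the m_k (`enorm_partialSum_le`). In place of an atomic decomposition, f is dominated
along its level sets: |f_{K+1}| ≤ ∑_k 2^{k+1} ∑_{l ≤ K} 1_{A_{k,l}}, where A_{k,l} has rank l and
collects the points at which a predictable stopping rule for the level 2^k stops at l. For fixed k
the measures of these sets add up to at most R μ(f^* > 2^k). So it suffices to treat one set A of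
rank l. For j ≥ l, E_j 1_A is at most 1_A, and there are at most K + 1 such j, which the weight at n
absorbs. For j < l, E_j 1_A is either 0 or at least M_j/M_l, so (E_j 1_A)^p has integral at most
(M_l/M_j)^{1-p} μ(A); after division by the p-th power of the weight at M_l these bounds sum to
O(μ(A)), by a geometric series if p < 1 and because l = O(log M_l) if p = 1. Summing 2^{kp} μ(f^* >
2^k) over k returns ∫ (f^*)^p. (b) The martingale with differences (ε_l M_l)^{1/p} 1_{I_l(0)} r_l
lies in H_p as soon as ∑ ε_l < ∞. Its coefficients on [M_n, 2M_n) are constant, so S_{M_n+q} f = f_n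
+ ε_n^{1/p} M_n^{1/p-1} r_n D_q for q ≤ M_n. For p < 1 take q = 1, where |D_1| = 1, and look off
I_1(0), where f_n = 0. For p = 1 take q = M_0 + M_2 + ⋯, whose Lebesgue constant grows like n, while
f_n is controlled by f^*. A sparse choice of ε then defeats φ. -/

theorem bigM_pos [∀ k, NeZero (m k)] (k : ℕ) : 0 < bigM m k := by
  induction k with
  | zero => exact Nat.one_pos
  | succ k ih => exact Nat.mul_pos (Nat.pos_of_ne_zero (NeZero.ne _)) ih

theorem bigM_dvd {j k : ℕ} (h : j ≤ k) : bigM m j ∣ bigM m k := by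
  induction k, h using Nat.le_induction with
  | base => exact dvd_rfl
  | succ k _ ih => exact ih.mul_left _

theorem bigM_mono [∀ k, NeZero (m k)] {j k : ℕ} (h : j ≤ k) : bigM m j ≤ bigM m k :=
  Nat.le_of_dvd (bigM_pos k) (bigM_dvd h)

theorem two_mul_bigM_le (hm : ∀ k, 2 ≤ m k) (k : ℕ) : 2 * bigM m k ≤ bigM m (k + 1) :=
  Nat.mul_le_mul_right _ (hm k)

theorem two_pow_le_bigM (hm : ∀ k, 2 ≤ m k) (k : ℕ) : 2 ^ k ≤ bigM m k := by
  induction k with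
  | zero => exact le_rfl
  | succ k ih =>
    have := two_mul_bigM_le hm k
    rw [pow_succ]
    omega

theorem bigM_le_pow {R : ℕ} (hR : ∀ k, m k ≤ R) (k : ℕ) : bigM m k ≤ R ^ k := by
  induction k with
  | zero => exact le_rfl
  | succ k ih =>
    rw [pow_succ, mul_comm]
    exact Nat.mul_le_mul (hR k) ih

theorem lt_bigM (hm : ∀ k, 2 ≤ m k) (k : ℕ) : k < bigM m k :=
  Nat.lt_two_pow_self.trans_le (two_pow_le_bigM hm k)

theorem exists_bigM_le_lt (hm : ∀ k, 2 ≤ m k) {n : ℕ} (hn : n ≠ 0) :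
    ∃ K, bigM m K ≤ n ∧ n < bigM m (K + 1) := by
  classical
  have h : ∃ K, n < bigM m K := ⟨n, lt_bigM hm n⟩
  obtain ⟨K, hK⟩ : ∃ K, Nat.find h = K + 1 := by
    refine Nat.exists_eq_succ_of_ne_zero fun h0 => ?_
    have := Nat.find_spec h
    rw [h0] at this
    exact hn (Nat.lt_one_iff.mp this)
  refine ⟨K, not_lt.mp (Nat.find_min h (by omega)), ?_⟩
  rw [← hK]
  exact Nat.find_spec h

theorem digit_eq_zero {n k : ℕ} (h : n < bigM m k) : digit m n k = 0 := by
  simp [digit, Nat.div_eq_of_lt h]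

theorem digit_eq_mod_div (n k : ℕ) : digit m n k = n % bigM m (k + 1) / bigM m k := by
  rw [digit, bigM, mul_comm, Nat.mod_mul_right_div_self]

theorem digit_mul_bigM_of_lt [∀ k, NeZero (m k)] {j k : ℕ} (a : ℕ) (h : k < j) :
    digit m (a * bigM m j) k = 0 := by
  rw [digit_eq_mod_div, Nat.mod_eq_zero_of_dvd ((bigM_dvd h).mul_left a), Nat.zero_div]

/-- There is no carry: i occupies the positions below j and a M_j those from j on. This is what
makes ψ multiplicative on such sums. -/
theorem digit_add_mul_bigM [∀ k, NeZero (m k)] {i j : ℕ} (a k : ℕ) (h : i < bigM m j) :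
    digit m (i + a * bigM m j) k = digit m i k + digit m (a * bigM m j) k := by
  rcases lt_or_ge k j with hk | hk
  · obtain ⟨t, ht⟩ := bigM_dvd (m := m) (Nat.succ_le_of_lt hk)
    rw [digit_mul_bigM_of_lt a hk, digit_eq_mod_div, digit_eq_mod_div, ht,
      show i + a * (bigM m k.succ * t) = i + bigM m k.succ * (t * a) by ring,
      Nat.add_mul_mod_self_left, add_zero]
  · rw [digit_eq_zero (h.trans_le (bigM_mono hk)), zero_add]
    obtain ⟨t, ht⟩ := bigM_dvd (m := m) hk
    simp only [digit]
    rw [ht, ← Nat.div_div_eq_div_mul, ← Nat.div_div_eq_div_mul,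
      Nat.add_mul_div_right _ _ (bigM_pos j), Nat.mul_div_cancel _ (bigM_pos j),
      Nat.div_eq_of_lt h, zero_add]

theorem digit_mul_bigM_self [∀ k, NeZero (m k)] {d j k : ℕ} (h : d < m j) :
    digit m (d * bigM m j) k = if k = j then d else 0 := by
  rcases lt_trichotomy k j with hk | rfl | hk
  · rw [digit_mul_bigM_of_lt d hk, if_neg hk.ne]
  · rw [if_pos rfl, digit, Nat.mul_div_cancel _ (bigM_pos k), Nat.mod_eq_of_lt h]
  · rw [if_neg hk.ne', digit_eq_zero]
    calc d * bigM m j < m j * bigM m j := Nat.mul_lt_mul_of_pos_right h (bigM_pos j)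
      _ = bigM m (j + 1) := rfl
      _ ≤ bigM m k := bigM_mono hk

/-! ### Vilenkin functions -/

theorem rademacher_eq [∀ k, NeZero (m k)] (k : ℕ) (x : Group m) :
    rademacher m k x = ZMod.stdAddChar (x k) := by
  rw [ZMod.stdAddChar_apply, ZMod.toCircle_apply, rademacher]

theorem norm_rademacher [∀ k, NeZero (m k)] (k : ℕ) (x : Group m) : ‖rademacher m k x‖ = 1 := by
  rw [rademacher_eq, ZMod.stdAddChar_apply, Circle.norm_coe]

theorem rademacher_mul_conj [∀ k, NeZero (m k)] (k : ℕ) (x y : Group m) :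
    rademacher m k x * (starRingEnd ℂ) (rademacher m k y) = ZMod.stdAddChar (x k - y k) := by
  rw [rademacher_eq, rademacher_eq, AddChar.map_sub_eq_div, ← AddChar.map_neg_eq_conj,
    AddChar.map_neg_eq_inv, div_eq_mul_inv]

theorem sum_pow_stdAddChar (N : ℕ) [NeZero N] (z : ZMod N) :
    ∑ d ∈ Finset.range N, (ZMod.stdAddChar z : ℂ) ^ d = if z = 0 then (N : ℂ) else 0 := by
  split_ifs with h
  · simp [h]
  · have h1 : (ZMod.stdAddChar z : ℂ) ≠ 1 := fun h2 =>
      h (ZMod.injective_stdAddChar (h2.trans (AddChar.map_zero_eq_one _).symm))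
    rw [geom_sum_eq h1, ← AddChar.map_nsmul_eq_pow]
    simp

/-- Brings characters of different indices to products of a common length, which can then be
multiplied factor by factor. -/
theorem psi_eq_prod [∀ k, NeZero (m k)] {n : ℕ} (hm : ∀ k, 2 ≤ m k) (K : ℕ) (hK : n ≤ K)
    (x : Group m) : psi m n x = ∏ k ∈ Finset.range K, rademacher m k x ^ digit m n k := by
  refine Finset.prod_subset (Finset.range_mono hK) fun k _ hk => ?_
  rw [Finset.mem_range, not_lt] at hk
  rw [digit_eq_zero ((lt_bigM hm n).trans_le (bigM_mono hk)), pow_zero]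

theorem norm_psi [∀ k, NeZero (m k)] (n : ℕ) (x : Group m) : ‖psi m n x‖ = 1 := by
  simp [psi, norm_rademacher]

theorem enorm_psi [∀ k, NeZero (m k)] (n : ℕ) (x : Group m) : ‖psi m n x‖ₑ = 1 := by
  rw [← ofReal_norm, norm_psi, ENNReal.ofReal_one]

theorem psi_add_mul_bigM [∀ k, NeZero (m k)] (hm : ∀ k, 2 ≤ m k) {i j : ℕ} (a : ℕ)
    (h : i < bigM m j) (x : Group m) :
    psi m (i + a * bigM m j) x = psi m i x * psi m (a * bigM m j) x := by
  rw [psi_eq_prod hm (i + a * bigM m j) le_rfl, psi_eq_prod hm (i + a * bigM m j) (by omega),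
    psi_eq_prod hm (i + a * bigM m j) (by omega), ← Finset.prod_mul_distrib]
  refine Finset.prod_congr rfl fun k _ => ?_
  rw [digit_add_mul_bigM a k h, pow_add]

theorem psi_mul_bigM [∀ k, NeZero (m k)] (hm : ∀ k, 2 ≤ m k) {d j : ℕ} (h : d < m j)
    (x : Group m) : psi m (d * bigM m j) x = rademacher m j x ^ d := by
  rw [psi_eq_prod hm (d * bigM m j + (j + 1)) (by omega)]
  rw [Finset.prod_eq_single j]
  · rw [digit_mul_bigM_self h, if_pos rfl]
  · intro k _ hk
    rw [digit_mul_bigM_self h, if_neg hk, pow_zero]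
  · intro hj
    exact absurd (Finset.mem_range.mpr (by omega)) hj

theorem psi_bigM_add [∀ k, NeZero (m k)] (hm : ∀ k, 2 ≤ m k) {i j : ℕ}
    (h : i < bigM m j) (x : Group m) :
    psi m (bigM m j + i) x = rademacher m j x * psi m i x := by
  have h1 := psi_mul_bigM hm (d := 1) (j := j) (hm j) x
  have h2 := psi_add_mul_bigM hm 1 h x
  rw [one_mul] at h1 h2
  rw [add_comm, h2, h1, pow_one, mul_comm]

theorem rademacher_zero (k : ℕ) : rademacher m k 0 = 1 := by
  simp [rademacher]

theorem psi_zero (n : ℕ) : psi m n 0 = 1 := by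
  simp [psi, rademacher_zero]

/-! ### Functions depending on the first coordinates -/

/-- The function `h` is constant on the intervals of rank `n`. -/
def RankConst {α : Type*} (m : ℕ → ℕ) (n : ℕ) (h : Group m → α) : Prop :=
  ∀ x, ∀ y ∈ interval m n x, h y = h x

theorem mem_interval_self (n : ℕ) (x : Group m) : x ∈ interval m n x := fun _ _ => rfl

theorem mem_interval_comm {n : ℕ} {x y : Group m} :
    y ∈ interval m n x ↔ x ∈ interval m n y :=
  ⟨fun h k hk => (h k hk).symm, fun h k hk => (h k hk).symm⟩

theorem mem_interval_trans {n : ℕ} {x y z : Group m} (h : y ∈ interval m n x)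
    (h' : z ∈ interval m n y) : z ∈ interval m n x :=
  fun k hk => (h' k hk).trans (h k hk)

theorem interval_anti {n l : ℕ} (h : n ≤ l) (x : Group m) : interval m l x ⊆ interval m n x :=
  fun _ hy k hk => hy k (hk.trans_le h)

theorem interval_eq_of_mem {n : ℕ} {x y : Group m} (h : y ∈ interval m n x) :
    interval m n y = interval m n x :=
  Set.Subset.antisymm (fun _ hz => mem_interval_trans h hz)
    fun _ hz => mem_interval_trans (mem_interval_comm.mp h) hz

theorem RankConst.mono {α : Type*} {n l : ℕ} {h : Group m → α} (hh : RankConst m n h)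
    (hnl : n ≤ l) : RankConst m l h :=
  fun x y hy => hh x y (interval_anti hnl x hy)

theorem rankConst_rademacher {k n : ℕ} (h : k < n) : RankConst m n (rademacher m k) := by
  intro x y hy
  rw [rademacher, rademacher, hy k h]

theorem rankConst_psi [∀ k, NeZero (m k)] {i n : ℕ} (h : i < bigM m n) :
    RankConst m n (psi m i) := by
  intro x y hy
  refine Finset.prod_congr rfl fun k _ => ?_
  rcases lt_or_ge k n with hk | hk
  · rw [rankConst_rademacher hk x y hy]
  · rw [digit_eq_zero (h.trans_le (bigM_mono hk)), pow_zero, pow_zero]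

theorem finite_range_interval [∀ k, NeZero (m k)] (n : ℕ) :
    (Set.range (interval m n)).Finite := by
  let g : (∀ k : Fin n, ZMod (m k)) → Set (Group m) := fun z => {y | ∀ k : Fin n, y k = z k}
  refine (Set.finite_range g).subset ?_
  rintro _ ⟨x, rfl⟩
  refine ⟨fun k => x k, ?_⟩
  ext y
  exact ⟨fun h k hk => h ⟨k, hk⟩, fun h k => h k k.2⟩

/-- Such a set is a union of intervals of rank n, and there are only finitely many of these.
Together with `rankConst_of_measurableSet` this replaces measurability at rank n by a pointwise
condition. -/
theorem RankConst.measurableSet [∀ k, NeZero (m k)] {n : ℕ} {A : Set (Group m)}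
    (hA : RankConst m n (· ∈ A)) : MeasurableSet[sigmaAlg m n] A := by
  have h : A = ⋃₀ {T | T ∈ Set.range (interval m n) ∧ T ⊆ A} := by
    ext x
    refine ⟨fun hx => ⟨interval m n x, ⟨⟨x, rfl⟩, fun y hy => ?_⟩, mem_interval_self n x⟩, ?_⟩
    · exact (hA x y hy).mpr hx
    · rintro ⟨T, ⟨-, hT⟩, hx⟩
      exact hT hx
  rw [h]
  exact MeasurableSet.sUnion ((finite_range_interval n).subset fun T hT => hT.1).countable
    fun T hT => MeasurableSpace.measurableSet_generateFrom hT.1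

theorem rankConst_of_measurableSet {n : ℕ} {A : Set (Group m)}
    (hA : MeasurableSet[sigmaAlg m n] A) : RankConst m n (· ∈ A) := by
  induction A, hA using MeasurableSpace.generateFrom_induction with
  | hC A h _ =>
    obtain ⟨z, rfl⟩ := h
    intro x y hy
    exact propext ⟨fun h => mem_interval_trans h (mem_interval_comm.mp hy),
      fun h => mem_interval_trans h hy⟩
  | empty => exact fun _ _ _ => rfl
  | compl A _ ih => exact fun x y hy => congrArg Not (ih x y hy)
  | iUnion A _ ih =>
    intro x y hy
    have := fun i => ih i x y hy
    simp only [Set.mem_iUnion]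
    simp only [this]

theorem RankConst.measurable_sigmaAlg [∀ k, NeZero (m k)] {α : Type*} [MeasurableSpace α] {n : ℕ}
    {h : Group m → α} (hh : RankConst m n h) : Measurable[sigmaAlg m n] h := by
  intro s _
  refine RankConst.measurableSet fun x y hy => ?_
  simp only [Set.mem_preimage, hh x y hy]

theorem RankConst.measurable [∀ k, NeZero (m k)] {α : Type*} [MeasurableSpace α] {n : ℕ}
    {h : Group m → α} (hh : RankConst m n h) : Measurable h :=
  hh.measurable_sigmaAlg.mono ((filtration m).le n) le_rfl

theorem rankConst_of_stronglyMeasurable {n : ℕ} {h : Group m → ℂ}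
    (hh : StronglyMeasurable[sigmaAlg m n] h) : RankConst m n h := by
  intro x y hy
  have : MeasurableSet[sigmaAlg m n] (h ⁻¹' {h x}) := hh.measurable (measurableSet_singleton _)
  exact (rankConst_of_measurableSet this x y hy).mpr rfl

/-! ### The Haar measure -/

instance [∀ k, NeZero (m k)] (k : ℕ) : IsProbabilityMeasure (coordMeasure m k) := by
  constructor
  rw [coordMeasure, Measure.smul_apply, Measure.count_apply MeasurableSet.univ]
  simp only [Set.encard_univ, ENat.card_eq_coe_fintype_card, ZMod.card, smul_eq_mul]
  exact ENNReal.inv_mul_cancel (by simp [NeZero.ne]) (by simp)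

instance [∀ k, NeZero (m k)] : IsProbabilityMeasure (haar m) := by
  unfold haar
  infer_instance

theorem coordMeasure_singleton (k : ℕ) (z : ZMod (m k)) :
    coordMeasure m k {z} = (m k : ℝ≥0∞)⁻¹ := by
  simp [coordMeasure]

theorem haar_interval [∀ k, NeZero (m k)] (n : ℕ) (x : Group m) :
    haar m (interval m n x) = (bigM m n : ℝ≥0∞)⁻¹ := by
  have h : interval m n x = ((Finset.range n : Finset ℕ) : Set ℕ).pi fun k => {x k} := by
    ext y
    simp [interval, Set.mem_pi]
  rw [h, haar, Measure.infinitePi_pi _ fun k _ => measurableSet_singleton _]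
  clear h
  simp only [coordMeasure_singleton]
  induction n with
  | zero => simp [bigM]
  | succ n ih =>
    rw [Finset.prod_range_succ, ih, bigM, Nat.cast_mul, ENNReal.mul_inv (by simp [NeZero.ne]) (by simp), mul_comm]

theorem measurePreserving_add_right [∀ k, NeZero (m k)] (e : Group m) :
    MeasurePreserving (fun x => x + e) (haar m) (haar m) := by
  refine ⟨measurable_pi_lambda _ fun k => ?_, ?_⟩
  · exact (measurable_of_finite fun z : ZMod (m k) => z + e k).comp (measurable_pi_apply k)
  · have h := Measure.infinitePi_map_pi (coordMeasure m) (f := fun k z => z + e k)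
      fun k => measurable_of_finite _
    refine h.trans ?_
    rw [haar]
    congr 1
    funext k
    rw [coordMeasure, Measure.map_smul, map_add_right_eq_self]

/-- Translation by the unit vector in coordinate n preserves the measure, does not change h, and
multiplies r_n by a root of unity different from 1; the integral therefore equals a nontrivial
multiple of itself. -/
theorem integral_mul_rademacher [∀ k, NeZero (m k)] (hm : ∀ k, 2 ≤ m k) {n : ℕ} {h : Group m → ℂ}
    (hh : RankConst m n h) : ∫ x, h x * rademacher m n x ∂haar m = 0 := by
  set e : Group m := Pi.single n 1
  have hF : Measurable fun x => h x * rademacher m n x :=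
    hh.measurable.mul (rankConst_rademacher (Nat.lt_succ_self n)).measurable
  have h1 : ∫ x, h (x + e) * rademacher m n (x + e) ∂haar m
      = ∫ x, h x * rademacher m n x ∂haar m := by
    have hp := measurePreserving_add_right (m := m) e
    have h0 := integral_map (μ := haar m) hp.measurable.aemeasurable
      (hF.aestronglyMeasurable (μ := (haar m).map fun x => x + e))
    rw [hp.map_eq] at h0
    exact h0.symm
  have h2 : ∀ x, h (x + e) * rademacher m n (x + e)
      = (ZMod.stdAddChar (1 : ZMod (m n)) : ℂ) * (h x * rademacher m n x) := by
    intro x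
    have : h (x + e) = h x := hh x _ fun k hk => by
      simp [e, Pi.single_eq_of_ne hk.ne]
    rw [this, rademacher_eq, rademacher_eq, Pi.add_apply, AddChar.map_add_eq_mul]
    simp only [e, Pi.single_eq_same]
    ring
  simp only [h2] at h1
  rw [integral_const_mul] at h1
  have h3 : (ZMod.stdAddChar (1 : ZMod (m n)) : ℂ) ≠ 1 := by
    intro h4
    have : Fact (1 < m n) := ⟨hm n⟩
    exact one_ne_zero (ZMod.injective_stdAddChar (h4.trans (AddChar.map_zero_eq_one _).symm))
  by_contra h5
  exact h3 (mul_right_cancel₀ h5 (h1.trans (one_mul _).symm))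

theorem integral_mul_conj_rademacher [∀ k, NeZero (m k)] (hm : ∀ k, 2 ≤ m k) {n : ℕ}
    {h : Group m → ℂ} (hh : RankConst m n h) :
    ∫ x, h x * (starRingEnd ℂ) (rademacher m n x) ∂haar m = 0 := by
  have h1 : RankConst m n fun x => (starRingEnd ℂ) (h x) := fun x y hy => by
    simp only [hh x y hy]
  have h2 := congrArg (starRingEnd ℂ) (integral_mul_rademacher hm h1)
  rw [← integral_conj] at h2
  simpa using h2

/-! ### Averages over intervals -/

/-- The average of `u` over the interval of rank `n` around `x`. -/
def average (m : ℕ → ℕ) (n : ℕ) (u : Group m → ℝ≥0∞) (x : Group m) : ℝ≥0∞ :=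
  bigM m n * ∫⁻ y in interval m n x, u y ∂haar m

theorem average_mono {n : ℕ} {u v : Group m → ℝ≥0∞} (h : ∀ y, u y ≤ v y) (x : Group m) :
    average m n u x ≤ average m n v x :=
  mul_le_mul_right (lintegral_mono h) _

theorem average_const_mul {n : ℕ} (c : ℝ≥0∞) {u : Group m → ℝ≥0∞} (hu : Measurable u)
    (x : Group m) : average m n (fun y => c * u y) x = c * average m n u x := by
  rw [average, average, lintegral_const_mul c hu, mul_left_comm]

theorem average_finset_sum {ι : Type*} (s : Finset ι) {n : ℕ} {u : ι → Group m → ℝ≥0∞}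
    (hu : ∀ i, Measurable (u i)) (x : Group m) :
    average m n (fun y => ∑ i ∈ s, u i y) x = ∑ i ∈ s, average m n (u i) x := by
  simp only [average]
  rw [lintegral_finsetSum s fun i _ => hu i, Finset.mul_sum]

theorem average_tsum {ι : Type*} [Countable ι] {n : ℕ} {u : ι → Group m → ℝ≥0∞}
    (hu : ∀ i, Measurable (u i)) (x : Group m) :
    average m n (fun y => ∑' i, u i y) x = ∑' i, average m n (u i) x := by
  simp only [average]
  rw [lintegral_tsum fun i => (hu i).aemeasurable, ENNReal.tsum_mul_left]

theorem bigM_mul_haar_interval [∀ k, NeZero (m k)] (n : ℕ) (x : Group m) :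
    bigM m n * haar m (interval m n x) = 1 := by
  rw [haar_interval]
  exact ENNReal.mul_inv_cancel (by simp [(bigM_pos n).ne']) (by simp)

theorem rankConst_average (n : ℕ) (u : Group m → ℝ≥0∞) : RankConst m n (average m n u) := by
  intro x y hy
  rw [average, average, interval_eq_of_mem hy]

theorem measurableSet_interval_prod (n : ℕ) :
    MeasurableSet {z : Group m × Group m | z.2 ∈ interval m n z.1} := by
  have h : {z : Group m × Group m | z.2 ∈ interval m n z.1}
      = ⋂ k : ℕ, ⋂ _ : k < n, {z | z.2 k = z.1 k} := by
    ext z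
    simp [interval]
  rw [h]
  have : ∀ k, Countable (ZMod (m k)) := fun k => by
    cases m k with
    | zero => exact inferInstanceAs (Countable ℤ)
    | succ l => exact inferInstanceAs (Countable (Fin (l + 1)))
  exact MeasurableSet.iInter fun k => MeasurableSet.iInter fun _ =>
    measurableSet_eq_fun ((measurable_pi_apply k).comp measurable_snd)
      ((measurable_pi_apply k).comp measurable_fst)

/-- Tonelli, since the relation y ∈ I_n(x) is symmetric and M_n μ(I_n(y)) = 1. -/
theorem lintegral_average [∀ k, NeZero (m k)] (n : ℕ) {u : Group m → ℝ≥0∞} (hu : Measurable u) :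
    ∫⁻ x, average m n u x ∂haar m = ∫⁻ x, u x ∂haar m := by
  have h : ∀ x, ∫⁻ y in interval m n x, u y ∂haar m
      = ∫⁻ y, {z : Group m × Group m | z.2 ∈ interval m n z.1}.indicator
        (fun z => u z.2) (x, y) ∂haar m := by
    intro x
    rw [← lintegral_indicator (measurableSet_interval m n x)]
    rfl
  have hmeas : Measurable ({z : Group m × Group m | z.2 ∈ interval m n z.1}.indicator
      fun z => u z.2) := (hu.comp measurable_snd).indicator (measurableSet_interval_prod n)
  simp only [average]
  rw [lintegral_const_mul']
  · simp only [h]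
    rw [lintegral_lintegral_swap (f := fun x y =>
      {z : Group m × Group m | z.2 ∈ interval m n z.1}.indicator (fun z => u z.2) (x, y))
      hmeas.aemeasurable, ← lintegral_const_mul _
      (Measurable.lintegral_prod_left' hmeas)]
    refine lintegral_congr fun y => ?_
    have h2 : ∀ x, {z : Group m × Group m | z.2 ∈ interval m n z.1}.indicator
        (fun z => u z.2) (x, y) = (interval m n y).indicator (fun _ => u y) x := by
      intro x
      have h3 : (x, y) ∈ {z : Group m × Group m | z.2 ∈ interval m n z.1} ↔ x ∈ interval m n y :=
        mem_interval_comm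
      by_cases hx : x ∈ interval m n y
      · rw [Set.indicator_of_mem hx, Set.indicator_of_mem (h3.mpr hx)]
      · rw [Set.indicator_of_notMem hx, Set.indicator_of_notMem (h3.not.mpr hx)]
    simp only [h2]
    rw [lintegral_indicator_const (measurableSet_interval m n y), mul_left_comm,
      bigM_mul_haar_interval, mul_one]
  · simp

/-! ### The Dirichlet kernels and partial sums -/

/-- The kernel of order M_j factorizes over the coordinates k < j; each factor is a full sum of
powers of an m_k-th root of unity. -/
theorem sum_psi_mul_conj [∀ k, NeZero (m k)] (hm : ∀ k, 2 ≤ m k) (j : ℕ) (x y : Group m)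
    [Decidable (y ∈ interval m j x)] :
    ∑ i ∈ Finset.range (bigM m j), psi m i x * (starRingEnd ℂ) (psi m i y)
      = if y ∈ interval m j x then (bigM m j : ℂ) else 0 := by
  classical
  suffices h : ∑ i ∈ Finset.range (bigM m j), psi m i x * (starRingEnd ℂ) (psi m i y)
      = ∏ k ∈ Finset.range j, if x k - y k = 0 then (m k : ℂ) else 0 by
    rw [h, Finset.prod_ite_zero]
    have h1 : (∀ k ∈ Finset.range j, x k - y k = 0) ↔ y ∈ interval m j x := by
      simp only [Finset.mem_range, interval, sub_eq_zero]
      exact ⟨fun h k hk => (h k hk).symm, fun h k hk => (h k hk).symm⟩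
    simp only [h1]
    congr 1
    clear h h1
    induction j with
    | zero => simp [bigM]
    | succ j ih => rw [Finset.prod_range_succ, ih, bigM, Nat.cast_mul, mul_comm]
  induction j with
  | zero => simp [bigM, psi]
  | succ j ih =>
    -- The block of frequencies starting at d M_j reproduces the kernel of order M_j, multiplied by
    -- the d-th power of r_j(x) times the conjugate of r_j(y).
    have hblock : ∀ d ≤ m j,
        ∑ i ∈ Finset.range (d * bigM m j), psi m i x * (starRingEnd ℂ) (psi m i y)
        = (∑ e ∈ Finset.range d, (ZMod.stdAddChar (x j - y j) : ℂ) ^ e) *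
          ∑ i ∈ Finset.range (bigM m j), psi m i x * (starRingEnd ℂ) (psi m i y) := by
      intro d hd
      induction d with
      | zero => simp
      | succ d ihd =>
        rw [Nat.succ_mul, Finset.sum_range_add, ihd (by omega), Finset.sum_range_succ, add_mul,
          Finset.mul_sum (Finset.range (bigM m j)) _ (_ ^ d)]
        congr 1
        refine Finset.sum_congr rfl fun i hi => ?_
        rw [add_comm, psi_add_mul_bigM hm d (Finset.mem_range.mp hi),
          psi_add_mul_bigM hm d (Finset.mem_range.mp hi), psi_mul_bigM hm hd, psi_mul_bigM hm hd,
          ← rademacher_mul_conj, map_mul, map_pow, mul_pow]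
        ring
    rw [Finset.prod_range_succ, ← ih, bigM, hblock _ le_rfl, sum_pow_stdAddChar, mul_comm]

/-- The Vilenkin–Fourier coefficient of a function. -/
def fourierCoeff (m : ℕ → ℕ) (g : Group m → ℂ) (i : ℕ) : ℂ :=
  ∫ x, g x * (starRingEnd ℂ) (psi m i x) ∂haar m

theorem measurable_psi [∀ k, NeZero (m k)] (i : ℕ) : Measurable (psi m i) :=
  Finset.measurable_prod _ fun k _ =>
    ((rankConst_rademacher (Nat.lt_succ_self k)).measurable).pow_const _

theorem integrable_mul_conj_psi [∀ k, NeZero (m k)] {g : Group m → ℂ}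
    (hg : Integrable g (haar m)) (i : ℕ) :
    Integrable (fun x => g x * (starRingEnd ℂ) (psi m i x)) (haar m) := by
  refine hg.mul_bdd (c := 1) ?_ ?_
  · exact (RCLike.continuous_conj.measurable.comp (measurable_psi i)).aestronglyMeasurable
  · exact Eventually.of_forall fun x => by rw [RCLike.norm_conj, norm_psi]

/-- Frequencies in [a M_j, (a+1) M_j) are those below M_j shifted by the character of index a M_j:
demodulate, average over I_j(x), modulate back. Characters have modulus 1, so the block is at most
the average of |g|. -/
theorem sum_fourierCoeff_block [∀ k, NeZero (m k)] (hm : ∀ k, 2 ≤ m k) {g : Group m → ℂ}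
    (hg : Integrable g (haar m)) (j a : ℕ) (x : Group m) :
    ∑ i ∈ Finset.range (bigM m j),
      fourierCoeff m g (i + a * bigM m j) * psi m (i + a * bigM m j) x
    = psi m (a * bigM m j) x * (bigM m j *
      ∫ y in interval m j x, g y * (starRingEnd ℂ) (psi m (a * bigM m j) y) ∂haar m) := by
  classical
  simp only [fourierCoeff, ← integral_mul_const]
  rw [← integral_finsetSum _ fun i _ => (integrable_mul_conj_psi hg _).mul_const _,
    ← integral_indicator (measurableSet_interval m j x), ← integral_const_mul,
    ← integral_const_mul]
  refine integral_congr_ae (Eventually.of_forall fun y => ?_)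
  have h : ∑ i ∈ Finset.range (bigM m j), g y * (starRingEnd ℂ) (psi m (i + a * bigM m j) y) *
        psi m (i + a * bigM m j) x
      = g y * (starRingEnd ℂ) (psi m (a * bigM m j) y) * psi m (a * bigM m j) x *
        ∑ i ∈ Finset.range (bigM m j), psi m i x * (starRingEnd ℂ) (psi m i y) := by
    rw [Finset.mul_sum]
    refine Finset.sum_congr rfl fun i hi => ?_
    rw [psi_add_mul_bigM hm a (Finset.mem_range.mp hi),
      psi_add_mul_bigM hm a (Finset.mem_range.mp hi), map_mul]
    ring
  simp only [h, sum_psi_mul_conj hm, Set.indicator_apply]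
  split_ifs
  · ring
  · ring

theorem sum_fourierCoeff_bigM [∀ k, NeZero (m k)] (hm : ∀ k, 2 ≤ m k) {g : Group m → ℂ}
    (hg : Integrable g (haar m)) (j : ℕ) (x : Group m) :
    ∑ i ∈ Finset.range (bigM m j), fourierCoeff m g i * psi m i x
      = bigM m j * ∫ y in interval m j x, g y ∂haar m := by
  have h := sum_fourierCoeff_block hm hg j 0 x
  simpa [psi] using h

theorem enorm_sum_fourierCoeff_block_le [∀ k, NeZero (m k)] (hm : ∀ k, 2 ≤ m k)
    {g : Group m → ℂ} (hg : Integrable g (haar m)) (j a : ℕ) (x : Group m) :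
    ‖∑ i ∈ Finset.range (bigM m j),
      fourierCoeff m g (i + a * bigM m j) * psi m (i + a * bigM m j) x‖ₑ
    ≤ average m j (fun y => ‖g y‖ₑ) x := by
  rw [sum_fourierCoeff_block hm hg, enorm_mul, enorm_psi, one_mul, enorm_mul, average]
  have h1 : ‖(bigM m j : ℂ)‖ₑ = (bigM m j : ℝ≥0∞) := by
    rw [← ofReal_norm, Complex.norm_natCast, ENNReal.ofReal_natCast]
  rw [h1]
  refine mul_le_mul_right ((enorm_integral_le_lintegral_enorm _).trans_eq ?_) _
  refine lintegral_congr fun y => ?_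
  rw [enorm_mul, RCLike.enorm_conj, enorm_psi, mul_one]

theorem enorm_sum_fourierCoeff_le [∀ k, NeZero (m k)] (hm : ∀ k, 2 ≤ m k) {R : ℕ}
    (hR : ∀ k, m k ≤ R) {g : Group m → ℂ} (hg : Integrable g (haar m)) (x : Group m) (j a n : ℕ)
    (hn : n < bigM m j) :
    ‖∑ i ∈ Finset.range n,
      fourierCoeff m g (i + a * bigM m j) * psi m (i + a * bigM m j) x‖ₑ
    ≤ R * ∑ l ∈ Finset.range j, average m l (fun y => ‖g y‖ₑ) x := by
  induction j generalizing a n with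
  | zero =>
    obtain rfl : n = 0 := Nat.lt_one_iff.mp hn
    simp
  | succ j ih =>
    -- Removing one full block raises the offset from a to a + 1, so the offset has to vary in the
    -- induction on the leading digit d.
    have key : ∀ d a n', n' < bigM m j →
        ‖∑ i ∈ Finset.range (d * bigM m j + n'),
          fourierCoeff m g (i + a * bigM m j) * psi m (i + a * bigM m j) x‖ₑ
        ≤ d * average m j (fun y => ‖g y‖ₑ) x
          + R * ∑ l ∈ Finset.range j, average m l (fun y => ‖g y‖ₑ) x := by
      intro d
      induction d with
      | zero =>
        intro a n' hn'
        simpa using ih a n' hn'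
      | succ d ihd =>
        intro a n' hn'
        rw [show (d + 1) * bigM m j + n' = bigM m j + (d * bigM m j + n') by ring,
          Finset.sum_range_add]
        refine (enorm_add_le _ _).trans ?_
        have h1 := ihd (a + 1) n' hn'
        simp only [show ∀ i, i + (a + 1) * bigM m j = bigM m j + i + a * bigM m j from
          fun i => by ring] at h1
        refine (add_le_add (enorm_sum_fourierCoeff_block_le hm hg j a x) h1).trans_eq ?_
        push_cast
        ring
    -- The offset a M_{j+1} is (a m_j) M_j, and the leading digit n / M_j is at most m_j ≤ R.
    have h1 := key (n / bigM m j) (a * m j) (n % bigM m j) (Nat.mod_lt _ (bigM_pos j))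
    rw [Nat.div_add_mod'] at h1
    simp only [mul_assoc] at h1
    refine h1.trans ?_
    rw [Finset.sum_range_succ, mul_add, add_comm]
    gcongr
    rw [bigM] at hn
    exact (Nat.le_of_lt (Nat.div_lt_of_lt_mul (by rwa [mul_comm]))).trans (hR j)

/-! ### Martingales -/

theorem rankConst_of_martingale {f : ℕ → Group m → ℂ} {μ : Measure (Group m)}
    (hf : Martingale f (filtration m) μ) (n : ℕ) : RankConst m n (f n) :=
  rankConst_of_stronglyMeasurable (hf.1 n)

theorem setIntegral_of_rankConst [∀ k, NeZero (m k)] {n : ℕ} {h : Group m → ℂ}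
    (hh : RankConst m n h) (x : Group m) :
    bigM m n * ∫ y in interval m n x, h y ∂haar m = h x := by
  have h1 : ∫ y in interval m n x, h y ∂haar m = ∫ _ in interval m n x, h x ∂haar m :=
    setIntegral_congr_fun (measurableSet_interval m n x) fun y hy => hh x y hy
  rw [h1, setIntegral_const, Measure.real, haar_interval, ENNReal.toReal_inv,
    ENNReal.toReal_natCast, Complex.real_smul, ← mul_assoc]
  push_cast
  rw [mul_inv_cancel₀ (Nat.cast_ne_zero.mpr (bigM_pos n).ne'), one_mul]

/-- The martingale property at every point, not just almost everywhere, because f_n is constant on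
intervals of rank n. -/
theorem eq_setIntegral_of_martingale [∀ k, NeZero (m k)] {f : ℕ → Group m → ℂ}
    (hf : Martingale f (filtration m) (haar m)) {n N : ℕ} (hnN : n ≤ N) (x : Group m) :
    bigM m n * ∫ y in interval m n x, f N y ∂haar m = f n x := by
  rw [← hf.setIntegral_eq hnN (MeasurableSpace.measurableSet_generateFrom ⟨x, rfl⟩)]
  exact setIntegral_of_rankConst (rankConst_of_martingale hf n) x

/-- For i < M_k the character is measurable at rank k, so it can be pulled out of the conditional
expectation. -/
theorem fourierCoeff_martingale_succ [∀ k, NeZero (m k)] {f : ℕ → Group m → ℂ}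
    (hf : Martingale f (filtration m) (haar m)) {k i : ℕ} (hi : i < bigM m k) :
    fourierCoeff m (f (k + 1)) i = fourierCoeff m (f k) i := by
  have hψ : RankConst m k fun x => (starRingEnd ℂ) (psi m i x) := fun x y hy => by
    simp only [rankConst_psi hi x y hy]
  have h := condExp_bilin_of_stronglyMeasurable_right (m := sigmaAlg m k) (μ := haar m)
    (ContinuousLinearMap.mul ℝ ℂ) (f := f (k + 1)) (g := fun x => (starRingEnd ℂ) (psi m i x))
    hψ.measurable_sigmaAlg.stronglyMeasurable
    (integrable_mul_conj_psi (hf.integrable (k + 1)) i) (hf.integrable (k + 1))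
  rw [fourierCoeff, fourierCoeff, ← integral_condExp ((filtration m).le k)]
  refine integral_congr_ae ?_
  filter_upwards [h, hf.2 k (k + 1) (Nat.le_succ k)] with x h1 h2
  refine h1.trans ?_
  simp only [ContinuousLinearMap.mul_apply']
  rw [← h2]
  rfl

theorem coeff_eq_fourierCoeff [∀ k, NeZero (m k)] {f : ℕ → Group m → ℂ}
    (hf : Martingale f (filtration m) (haar m)) {k i : ℕ} (hi : i < bigM m k) :
    coeff m f i = fourierCoeff m (f k) i := by
  refine Tendsto.limUnder_eq (tendsto_const_nhds.congr' ?_)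
  filter_upwards [eventually_ge_atTop k] with l hl
  change fourierCoeff m (f k) i = fourierCoeff m (f l) i
  induction l, hl using Nat.le_induction with
  | base => rfl
  | succ l hl ih =>
    rw [ih, fourierCoeff_martingale_succ hf (hi.trans_le (bigM_mono hl))]

theorem partialSum_eq [∀ k, NeZero (m k)] {f : ℕ → Group m → ℂ}
    (hf : Martingale f (filtration m) (haar m)) {k n : ℕ} (hn : n ≤ bigM m k) (x : Group m) :
    partialSum m f n x = ∑ i ∈ Finset.range n, fourierCoeff m (f k) i * psi m i x :=
  Finset.sum_congr rfl fun i hi => by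
    rw [coeff_eq_fourierCoeff hf ((Finset.mem_range.mp hi).trans_le hn)]

theorem partialSum_bigM [∀ k, NeZero (m k)] (hm : ∀ k, 2 ≤ m k) {f : ℕ → Group m → ℂ}
    (hf : Martingale f (filtration m) (haar m)) (k : ℕ) (x : Group m) :
    partialSum m f (bigM m k) x = f k x := by
  rw [partialSum_eq hf le_rfl, sum_fourierCoeff_bigM hm (hf.integrable k),
    eq_setIntegral_of_martingale hf le_rfl]

theorem enorm_partialSum_le [∀ k, NeZero (m k)] (hm : ∀ k, 2 ≤ m k) {R : ℕ}
    (hR : ∀ k, m k ≤ R) {f : ℕ → Group m → ℂ} (hf : Martingale f (filtration m) (haar m))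
    {n N : ℕ} (hn : n < bigM m N) (x : Group m) :
    ‖partialSum m f n x‖ₑ
      ≤ R * ∑ l ∈ Finset.range N, average m l (fun y => ‖f N y‖ₑ) x := by
  have h := enorm_sum_fourierCoeff_le hm hR (hf.integrable N) x N 0 n hn
  rw [partialSum_eq hf hn.le]
  simpa using h

theorem measurable_partialSum [∀ k, NeZero (m k)] (f : ℕ → Group m → ℂ) (n : ℕ) :
    Measurable (partialSum m f n) :=
  Finset.measurable_sum _ fun i _ => (measurable_psi i).const_mul _

/-! ### Subadditivity of powers -/

theorem rpow_sum_le {ι : Type*} (s : Finset ι) (u : ι → ℝ≥0∞) {p : ℝ} (hp : 0 < p) (hp1 : p ≤ 1) :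
    (∑ i ∈ s, u i) ^ p ≤ ∑ i ∈ s, u i ^ p := by
  classical
  induction s using Finset.induction_on with
  | empty => simp [hp]
  | insert a s ha ih =>
    rw [Finset.sum_insert ha, Finset.sum_insert ha]
    exact (ENNReal.rpow_add_le_add_rpow _ _ hp.le hp1).trans (add_le_add le_rfl ih)

theorem rpow_tsum_le {ι : Type*} (u : ι → ℝ≥0∞) {p : ℝ} (hp : 0 < p) (hp1 : p ≤ 1) :
    (∑' i, u i) ^ p ≤ ∑' i, u i ^ p := by
  have h1 : Tendsto (fun s : Finset ι => (∑ i ∈ s, u i) ^ p) atTop (nhds ((∑' i, u i) ^ p)) :=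
    (ENNReal.continuous_rpow_const.tendsto _).comp ENNReal.summable.hasSum
  refine le_of_tendsto h1 (Eventually.of_forall fun s => ?_)
  exact (rpow_sum_le s u hp hp1).trans (ENNReal.sum_le_tsum s)

/-! ### Decomposition of a martingale along its level sets -/

/-- The points whose interval of rank `l` meets `{|f_{l+1}| > t}`. -/
def exceedSet (m : ℕ → ℕ) (f : ℕ → Group m → ℂ) (t : ℝ≥0∞) (l : ℕ) : Set (Group m) :=
  {x | ∃ y ∈ interval m l x, t < ‖f (l + 1) y‖ₑ}

/-- The points for which `l` is the first rank at which `exceedSet` is entered. -/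
def firstExceedSet (m : ℕ → ℕ) (f : ℕ → Group m → ℂ) (t : ℝ≥0∞) (l : ℕ) : Set (Group m) :=
  {x | x ∈ exceedSet m f t l ∧ ∀ i < l, x ∉ exceedSet m f t i}

/-- Saturating a condition on f_{l+1} to intervals of rank l makes the stopping rule predictable:
the stopping set has rank l, yet it catches the exceedance before it occurs. -/
theorem rankConst_exceedSet (f : ℕ → Group m → ℂ) (t : ℝ≥0∞) (l : ℕ) :
    RankConst m l (· ∈ exceedSet m f t l) := by
  intro x y hy
  simp only [exceedSet, Set.mem_ofPred_eq, interval_eq_of_mem hy]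

theorem rankConst_firstExceedSet (f : ℕ → Group m → ℂ) (t : ℝ≥0∞) (l : ℕ) :
    RankConst m l (· ∈ firstExceedSet m f t l) := by
  intro x y hy
  simp only [firstExceedSet, Set.mem_ofPred_eq]
  refine propext (and_congr (rankConst_exceedSet f t l x y hy).to_iff
    (forall₂_congr fun i hi => not_congr ?_))
  exact (((rankConst_exceedSet f t i).mono hi.le) x y hy).to_iff

theorem measurableSet_firstExceedSet [∀ k, NeZero (m k)] (f : ℕ → Group m → ℂ) (t : ℝ≥0∞)
    (l : ℕ) : MeasurableSet (firstExceedSet m f t l) :=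
  (filtration m).le l _ (rankConst_firstExceedSet f t l).measurableSet

theorem pairwise_disjoint_firstExceedSet (f : ℕ → Group m → ℂ) (t : ℝ≥0∞) :
    Pairwise (Function.onFun Disjoint (firstExceedSet m f t)) := by
  have h : ∀ i j, i < j → Disjoint (firstExceedSet m f t i) (firstExceedSet m f t j) :=
    fun i j hij => Set.disjoint_left.mpr fun x hx hx' => hx'.2 i hij hx.1
  intro i j hij
  rcases lt_or_gt_of_ne hij with h1 | h1
  · exact h i j h1
  · exact (h j i h1).symm

theorem exists_mem_firstExceedSet {f : ℕ → Group m → ℂ} {t : ℝ≥0∞} {l : ℕ} {x : Group m}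
    (h : t < ‖f (l + 1) x‖ₑ) : ∃ i ≤ l, x ∈ firstExceedSet m f t i := by
  classical
  have h1 : ∃ i, x ∈ exceedSet m f t i := ⟨l, x, mem_interval_self l x, h⟩
  exact ⟨Nat.find h1, Nat.find_min' h1 ⟨x, mem_interval_self l x, h⟩, Nat.find_spec h1,
    fun i hi => Nat.find_min h1 hi⟩

/-- The indicator function with values in `[0, ∞]`. -/
def ind (A : Set (Group m)) : Group m → ℝ≥0∞ := A.indicator 1

theorem measurable_ind {A : Set (Group m)} (hA : MeasurableSet A) : Measurable (ind A) :=
  measurable_one.indicator hA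

theorem lintegral_ind {A : Set (Group m)} (hA : MeasurableSet A) :
    ∫⁻ x, ind A x ∂haar m = haar m A :=
  lintegral_indicator_one hA

theorem average_ind (n : ℕ) {A : Set (Group m)} (hA : MeasurableSet A) (x : Group m) :
    average m n (ind A) x = bigM m n * haar m (A ∩ interval m n x) := by
  rw [average, ind, lintegral_indicator_one hA, Measure.restrict_apply hA]

theorem average_ind_le_one [∀ k, NeZero (m k)] (n : ℕ) {A : Set (Group m)} (hA : MeasurableSet A)
    (x : Group m) : average m n (ind A) x ≤ 1 := by
  rw [average_ind n hA, ← bigM_mul_haar_interval n x]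
  gcongr
  exact Set.inter_subset_right

theorem average_ind_le_ind [∀ k, NeZero (m k)] {n : ℕ} {A : Set (Group m)}
    (hA : RankConst m n (· ∈ A)) (x : Group m) : average m n (ind A) x ≤ ind A x := by
  have hmeas : MeasurableSet A := (filtration m).le n _ hA.measurableSet
  by_cases hx : x ∈ A
  · rw [ind, Set.indicator_of_mem hx]
    exact average_ind_le_one n hmeas x
  · have : A ∩ interval m n x = ∅ :=
      Set.eq_empty_of_forall_notMem fun y hy => hx ((hA x y hy.2).to_iff.mp hy.1)
    rw [average_ind n hmeas, this]
    simp

/-- If A meets an interval of rank j, it contains a whole interval of rank l inside it, so the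
average is 0 or at least M_j/M_l. Then write a^p = a^{-(1-p)} a. -/
theorem average_ind_rpow_le [∀ k, NeZero (m k)] {j l : ℕ} (hjl : j ≤ l) {A : Set (Group m)}
    (hA : RankConst m l (· ∈ A)) {p : ℝ} (hp : 0 < p) (hp1 : p ≤ 1) (x : Group m) :
    average m j (ind A) x ^ p
      ≤ ((bigM m l : ℝ≥0∞) / bigM m j) ^ (1 - p) * average m j (ind A) x := by
  have hmeas : MeasurableSet A := (filtration m).le l _ hA.measurableSet
  rcases eq_or_ne (average m j (ind A) x) 0 with h0 | h0
  · rw [h0, ENNReal.zero_rpow_of_pos hp]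
    exact zero_le
  have htop : average m j (ind A) x ≠ ∞ :=
    ((average_ind_le_one j hmeas x).trans_lt ENNReal.one_lt_top).ne
  have hlow : (bigM m j : ℝ≥0∞) / bigM m l ≤ average m j (ind A) x := by
    rw [average_ind j hmeas] at h0 ⊢
    obtain ⟨y, hy⟩ := nonempty_of_measure_ne_zero (right_ne_zero_of_mul h0)
    rw [div_eq_mul_inv, ← haar_interval l y]
    gcongr
    refine fun z hz => ⟨(hA y z hz).to_iff.mpr hy.1, ?_⟩
    exact mem_interval_trans hy.2 (interval_anti hjl y hz)
  have hinv : (average m j (ind A) x)⁻¹ ≤ (bigM m l : ℝ≥0∞) / bigM m j := by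
    rw [← ENNReal.inv_div (by simp) (by simp [(bigM_pos j).ne'])]
    exact ENNReal.inv_le_inv.mpr hlow
  calc average m j (ind A) x ^ p
      = (average m j (ind A) x)⁻¹ ^ (1 - p) * average m j (ind A) x := by
        rw [ENNReal.inv_rpow, ← ENNReal.rpow_neg]
        nth_rewrite 3 [← ENNReal.rpow_one (average m j (ind A) x)]
        rw [← ENNReal.rpow_add _ _ h0 htop]
        congr 1
        ring
    _ ≤ _ := by
        gcongr

/-- Each interval of rank l in the stopping set has a subinterval of rank l + 1 on which |f_{l+1}| >
t, and this fills the proportion 1/m_l ≥ 1/R. This is where boundedness of m enters the level-set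
estimate. -/
theorem haar_firstExceedSet_le [∀ k, NeZero (m k)] {R : ℕ} (hR : ∀ k, m k ≤ R)
    {f : ℕ → Group m → ℂ} (hf : ∀ n, RankConst m n (f n)) (t : ℝ≥0∞) (l : ℕ) :
    haar m (firstExceedSet m f t l)
      ≤ R * haar m (firstExceedSet m f t l ∩ {x | t < maximalFunction m f x}) := by
  set A := firstExceedSet m f t l
  have hA : MeasurableSet A := measurableSet_firstExceedSet f t l
  set A' := A ∩ {x | t < ‖f (l + 1) x‖ₑ}
  have hA' : MeasurableSet A' :=
    hA.inter (measurableSet_lt measurable_const (hf (l + 1)).measurable.enorm)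
  have h1 : ∀ x, ind A x ≤ R * average m l (ind A') x := by
    intro x
    by_cases hx : x ∈ A
    · rw [ind, Set.indicator_of_mem hx, average_ind l hA', Pi.one_apply]
      obtain ⟨y, hy, hty⟩ := hx.1
      have hsub : interval m (l + 1) y ⊆ A' ∩ interval m l x := by
        intro z hz
        have hzx : z ∈ interval m l x :=
          mem_interval_trans hy (interval_anti (Nat.le_succ l) y hz)
        refine ⟨⟨(rankConst_firstExceedSet f t l x z hzx).to_iff.mpr hx, ?_⟩, hzx⟩
        change t < ‖f (l + 1) z‖ₑ
        rwa [hf (l + 1) y z hz]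
      calc (1 : ℝ≥0∞) = bigM m (l + 1) * haar m (interval m (l + 1) y) :=
            (bigM_mul_haar_interval _ _).symm
        _ = m l * (bigM m l * haar m (interval m (l + 1) y)) := by
            rw [bigM, Nat.cast_mul, mul_assoc]
        _ ≤ R * (bigM m l * haar m (A' ∩ interval m l x)) := by
            gcongr
            exact hR l
    · rw [ind, Set.indicator_of_notMem hx]
      exact zero_le
  calc haar m A = ∫⁻ x, ind A x ∂haar m := (lintegral_ind hA).symm
    _ ≤ ∫⁻ x, R * average m l (ind A') x ∂haar m := lintegral_mono h1
    _ = R * haar m A' := by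
        rw [lintegral_const_mul _ (rankConst_average l _).measurable,
          lintegral_average l (measurable_ind hA'), lintegral_ind hA']
    _ ≤ _ := by
        gcongr
        rintro x ⟨hx, hx'⟩
        exact ⟨hx, lt_of_lt_of_le hx' (le_iSup (fun n => ‖f n x‖ₑ) (l + 1))⟩

theorem measurable_maximalFunction [∀ k, NeZero (m k)] {f : ℕ → Group m → ℂ}
    (hf : ∀ n, RankConst m n (f n)) : Measurable (maximalFunction m f) :=
  Measurable.iSup fun n => (hf n).measurable.enorm

theorem tsum_haar_firstExceedSet_le [∀ k, NeZero (m k)] {R : ℕ} (hR : ∀ k, m k ≤ R)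
    {f : ℕ → Group m → ℂ} (hf : ∀ n, RankConst m n (f n)) (t : ℝ≥0∞) :
    ∑' l, haar m (firstExceedSet m f t l) ≤ R * haar m {x | t < maximalFunction m f x} := by
  have hF : MeasurableSet {x | t < maximalFunction m f x} :=
    measurableSet_lt measurable_const (measurable_maximalFunction hf)
  calc ∑' l, haar m (firstExceedSet m f t l)
      ≤ ∑' l, R * haar m (firstExceedSet m f t l ∩ {x | t < maximalFunction m f x}) :=
        ENNReal.tsum_le_tsum fun l => haar_firstExceedSet_le hR hf t l
    _ = R * haar m (⋃ l, firstExceedSet m f t l ∩ {x | t < maximalFunction m f x}) := by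
        rw [ENNReal.tsum_mul_left, measure_iUnion]
        · intro i j hij
          exact (pairwise_disjoint_firstExceedSet f t hij).mono Set.inter_subset_left
            Set.inter_subset_left
        · exact fun l => (measurableSet_firstExceedSet f t l).inter hF
    _ ≤ _ := by
        gcongr
        exact Set.iUnion_subset fun l => Set.inter_subset_right

/-- A single term suffices: the level k with 2^k < |f_{K+1}(x)| ≤ 2^{k+1}, at which x has been
stopped at some rank l ≤ K. The stopping sets do not see f_0, which is harmless since only f_{K+1}
is needed. -/
theorem enorm_le_tsum_level (f : ℕ → Group m → ℂ) (K : ℕ) (x : Group m) :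
    ‖f (K + 1) x‖ₑ ≤ ∑' k : ℤ, ∑ l ∈ Finset.range (K + 1),
      2 ^ (k + 1) * ind (firstExceedSet m f (2 ^ k) l) x := by
  rcases eq_or_ne ‖f (K + 1) x‖ₑ 0 with h0 | h0
  · rw [h0]
    exact zero_le
  obtain ⟨k, hk1, hk2⟩ := ENNReal.exists_mem_Ioc_zpow h0 (by simp) ENNReal.one_lt_two (by simp)
  obtain ⟨l, hl, hx⟩ := exists_mem_firstExceedSet hk1
  refine hk2.trans (le_trans ?_ (ENNReal.le_tsum k))
  refine le_trans ?_ (Finset.single_le_sum (fun _ _ => zero_le)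
    (Finset.mem_range.mpr (Nat.lt_succ_of_le hl)))
  rw [ind, Set.indicator_of_mem hx, Pi.one_apply, mul_one]

/-- A geometric series running down from the largest k with 2^k < v; it recovers ∫ (f^*)^p from the
measures of the level sets. -/
theorem tsum_zpow_rpow_le {p : ℝ} (hp : 0 < p) :
    ∃ C : ℝ≥0, ∀ v : ℝ≥0∞,
      ∑' k : ℤ, ((2 : ℝ≥0∞) ^ k) ^ p * (if (2 : ℝ≥0∞) ^ k < v then 1 else 0) ≤ C * v ^ p := by
  have hq : ((2 : ℝ≥0∞)⁻¹) ^ p < 1 := ENNReal.rpow_lt_one (by simp) hp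
  have hne : (1 - (2 : ℝ≥0∞)⁻¹ ^ p)⁻¹ ≠ ∞ := by
    rw [ENNReal.inv_ne_top]
    exact (tsub_pos_of_lt hq).ne'
  refine ⟨((1 - (2 : ℝ≥0∞)⁻¹ ^ p)⁻¹).toNNReal, fun v => ?_⟩
  rw [ENNReal.coe_toNNReal hne]
  rcases eq_or_ne v 0 with rfl | h0
  · simp
  rcases eq_or_ne v ∞ with rfl | htop
  · rw [ENNReal.top_rpow_of_pos hp, ENNReal.mul_top]
    · exact le_top
    · rw [ENNReal.inv_ne_zero]
      exact (tsub_le_self.trans_lt ENNReal.one_lt_top).ne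
  obtain ⟨n, hn1, hn2⟩ := ENNReal.exists_mem_Ioc_zpow h0 htop ENNReal.one_lt_two (by simp)
  have hinj : Function.Injective fun i : ℕ => n - (i : ℤ) := fun a b hab => by
    simpa using hab
  rw [← hinj.tsum_eq]
  · rw [← ENNReal.tsum_geometric, ← ENNReal.tsum_mul_right]
    refine ENNReal.tsum_le_tsum fun i => ?_
    have h1 : ((2 : ℝ≥0∞) ^ (n - (i : ℤ))) ≤ (2 : ℝ≥0∞)⁻¹ ^ i * v := by
      rw [sub_eq_add_neg, ENNReal.zpow_add (by simp) (by simp), mul_comm, ENNReal.zpow_neg,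
        zpow_natCast, ENNReal.inv_pow]
      gcongr
    calc _ ≤ ((2 : ℝ≥0∞) ^ (n - (i : ℤ))) ^ p * 1 := by
          gcongr
          split_ifs <;> simp
      _ ≤ ((2 : ℝ≥0∞)⁻¹ ^ i * v) ^ p := by
          rw [mul_one]
          gcongr
      _ = _ := by
          rw [ENNReal.mul_rpow_of_nonneg _ _ hp.le, ← ENNReal.rpow_natCast, ← ENNReal.rpow_mul,
            mul_comm (i : ℝ), ENNReal.rpow_mul, ENNReal.rpow_natCast]
  · intro k hk
    have hk' : (2 : ℝ≥0∞) ^ k < v := by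
      by_contra h
      simp [h] at hk
    have : k < n + 1 := by
      by_contra h
      have h2 : (2 : ℝ≥0∞) ^ (n + 1) ≤ 2 ^ k :=
        ENNReal.zpow_le_of_le one_le_two (not_lt.mp h)
      exact absurd (hn2.trans h2) (not_le.mpr hk')
    exact ⟨(n - k).toNat, by simp only; omega⟩

/-! ### Estimates of the weight -/

theorem weight_of_lt_one {p : ℝ} (hp1 : p < 1) (n : ℕ) :
    weight p n = ((n : ℝ) + 1) ^ (1 / p - 1) := by
  rw [weight, Nat.floor_eq_zero.mpr hp1, pow_zero, mul_one]

theorem weight_one (n : ℕ) : weight 1 n = Real.log ((n : ℝ) + 1) := by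
  simp [weight]

theorem one_div_sub_one_nonneg {p : ℝ} (hp : 0 < p) (hp1 : p ≤ 1) : 0 ≤ 1 / p - 1 :=
  sub_nonneg.mpr ((one_le_div hp).mpr hp1)

theorem weight_mono {p : ℝ} (hp : 0 < p) (hp1 : p ≤ 1) : Monotone (weight p) := by
  intro a b hab
  have h : (a : ℝ) ≤ b := Nat.cast_le.mpr hab
  have h0 : (0 : ℝ) ≤ a := Nat.cast_nonneg a
  have := one_div_sub_one_nonneg hp hp1
  unfold weight
  gcongr
  · exact pow_nonneg (Real.log_nonneg (by linarith)) _
  · exact Real.log_nonneg (by linarith)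

theorem weight_pos (p : ℝ) {n : ℕ} (hn : 1 ≤ n) : 0 < weight p n := by
  have h : (1 : ℝ) ≤ n := Nat.one_le_cast.mpr hn
  exact mul_pos (Real.rpow_pos_of_pos (by linarith) _) (pow_pos (Real.log_pos (by linarith)) _)

theorem exists_succ_le_mul_weight (hm : ∀ k, 2 ≤ m k) {p : ℝ} (hp : 0 < p) (hp1 : p ≤ 1) :
    ∃ C : ℝ, 0 ≤ C ∧ ∀ K : ℕ, (K : ℝ) + 1 ≤ C * weight p (bigM m K) := by
  have hM : ∀ K, (2 : ℝ) ^ K ≤ bigM m K := fun K => by exact_mod_cast two_pow_le_bigM hm K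
  rcases hp1.lt_or_eq with hp1 | rfl
  · have hs : 0 < 1 / p - 1 := sub_pos.mpr ((one_lt_div hp).mpr hp1)
    set a : ℝ := 2 ^ (1 / p - 1)
    have ha : 1 < a := Real.one_lt_rpow one_lt_two hs
    have ha' : 0 < a - 1 := sub_pos.mpr ha
    -- The weight at M_K is at least a^K, and Bernoulli gives K ≤ a^K/(a - 1); the summand 1 absorbs
    -- the remaining 1 ≤ a^K.
    refine ⟨1 + 1 / (a - 1), by positivity, fun K => ?_⟩
    have h1 : a ^ K ≤ weight p (bigM m K) := by
      rw [weight_of_lt_one hp1, ← Real.rpow_natCast, ← Real.rpow_mul zero_le_two, mul_comm,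
        Real.rpow_mul zero_le_two, Real.rpow_natCast]
      exact Real.rpow_le_rpow (by positivity) (by linarith [hM K]) hs.le
    have h2 : 1 + K * (a - 1) ≤ a ^ K := by
      have := one_add_mul_le_pow (a := a - 1) (by linarith) K
      rwa [add_sub_cancel] at this
    have h3 : (1 : ℝ) ≤ a ^ K := one_le_pow₀ ha.le
    calc (K : ℝ) + 1 = 1 / (a - 1) * (K * (a - 1)) + 1 := by field_simp
      _ ≤ 1 / (a - 1) * a ^ K + a ^ K := by
          gcongr
          linarith
      _ = (1 + 1 / (a - 1)) * a ^ K := by ring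
      _ ≤ _ := by gcongr
  · have hl : 0 < Real.log 2 := Real.log_pos one_lt_two
    refine ⟨2 / Real.log 2, by positivity, fun K => ?_⟩
    rw [weight_one, div_mul_eq_mul_div, le_div_iff₀ hl]
    have h1 : K * Real.log 2 ≤ Real.log (bigM m K + 1) := by
      rw [← Real.log_pow]
      exact Real.log_le_log (by positivity) (by linarith [hM K])
    have h2 : Real.log 2 ≤ Real.log (bigM m K + 1) :=
      Real.log_le_log (by positivity) (by linarith [hM K, one_le_pow₀ (n := K) one_le_two (M₀ := ℝ)])
    linarith

/-- For p < 1 the p-th power of the weight is at least M_l^{1-p}, leaving ∑ M_j^{-(1-p)}, which is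
geometric. For p = 1 the l equal terms are absorbed by the logarithm. -/
theorem sum_div_weight_rpow_le [∀ k, NeZero (m k)] (hm : ∀ k, 2 ≤ m k) {p : ℝ} (hp : 0 < p)
    (hp1 : p ≤ 1) : ∃ C : ℝ≥0, ∀ l, ∑ j ∈ Finset.range l,
      ((bigM m l : ℝ≥0∞) / bigM m j) ^ (1 - p) / ENNReal.ofReal (weight p (bigM m l)) ^ p ≤ C := by
  rcases hp1.lt_or_eq with hp1 | rfl
  · have hs : 0 < 1 - p := sub_pos.mpr hp1
    have hq : (2 : ℝ≥0∞)⁻¹ ^ (1 - p) < 1 := ENNReal.rpow_lt_one (by simp) hs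
    have hne : (1 - (2 : ℝ≥0∞)⁻¹ ^ (1 - p))⁻¹ ≠ ∞ := by
      rw [ENNReal.inv_ne_top]
      exact (tsub_pos_of_lt hq).ne'
    refine ⟨((1 - (2 : ℝ≥0∞)⁻¹ ^ (1 - p))⁻¹).toNNReal, fun l => ?_⟩
    rw [ENNReal.coe_toNNReal hne, ← ENNReal.tsum_geometric]
    refine le_trans (Finset.sum_le_sum fun j _ => ?_) (ENNReal.sum_le_tsum (Finset.range l))
    refine ENNReal.div_le_of_le_mul ?_
    have hw : (bigM m l : ℝ≥0∞) ^ (1 - p) ≤ ENNReal.ofReal (weight p (bigM m l)) ^ p := by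
      rw [weight_of_lt_one hp1, ENNReal.ofReal_rpow_of_nonneg (by positivity) hp.le,
        ← Real.rpow_mul (by positivity), show (1 / p - 1) * p = 1 - p by field_simp,
        ← ENNReal.ofReal_rpow_of_nonneg (by positivity) hs.le]
      refine ENNReal.rpow_le_rpow ?_ hs.le
      rw [← ENNReal.ofReal_natCast]
      exact ENNReal.ofReal_le_ofReal (by linarith)
    have hj : ((bigM m j : ℝ≥0∞)⁻¹) ^ (1 - p) ≤ ((2 : ℝ≥0∞)⁻¹ ^ (1 - p)) ^ j := by
      rw [← ENNReal.rpow_natCast, ← ENNReal.rpow_mul, mul_comm, ENNReal.rpow_mul,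
        ENNReal.rpow_natCast, ← ENNReal.inv_pow]
      refine ENNReal.rpow_le_rpow (ENNReal.inv_le_inv.mpr ?_) hs.le
      exact_mod_cast two_pow_le_bigM hm j
    rw [div_eq_mul_inv, ENNReal.mul_rpow_of_nonneg _ _ hs.le, mul_comm]
    exact mul_le_mul' hj hw
  · obtain ⟨C, hC0, hC⟩ := exists_succ_le_mul_weight hm one_pos le_rfl
    refine ⟨C.toNNReal, fun l => ?_⟩
    simp only [sub_self, ENNReal.rpow_zero, ENNReal.rpow_one, Finset.sum_const, Finset.card_range,
      nsmul_eq_mul, mul_one_div]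
    refine ENNReal.div_le_of_le_mul ?_
    rw [← ENNReal.ofReal_natCast, ← ENNReal.ofReal, ← ENNReal.ofReal_mul hC0]
    exact ENNReal.ofReal_le_ofReal (by linarith [hC l])

/-! ### The weighted maximal operator -/

/-- The contribution of one level set to the majorant of the weighted maximal operator. -/
def levelMajorant (m : ℕ → ℕ) (p : ℝ) (C : ℝ≥0∞) (A : Set (Group m)) (l : ℕ) (x : Group m) :
    ℝ≥0∞ :=
  C * ind A x + ∑ j ∈ Finset.range l,
    average m j (ind A) x / ENNReal.ofReal (weight p (bigM m l))

theorem sum_average_ind_le [∀ k, NeZero (m k)] {p : ℝ} (hp : 0 < p) (hp1 : p ≤ 1)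
    {C : ℝ} (hC0 : 0 ≤ C) (hC : ∀ K : ℕ, (K : ℝ) + 1 ≤ C * weight p (bigM m K))
    {l K n : ℕ} (hl : l ≤ K) (hn : bigM m K ≤ n) {A : Set (Group m)}
    (hA : RankConst m l (· ∈ A)) (x : Group m) :
    ∑ j ∈ Finset.range (K + 1), average m j (ind A) x
      ≤ levelMajorant m p (ENNReal.ofReal C) A l x * ENNReal.ofReal (weight p n) := by
  have hw : ∀ k ≤ K, ENNReal.ofReal (weight p (bigM m k)) ≤ ENNReal.ofReal (weight p n) :=
    fun k hk => ENNReal.ofReal_le_ofReal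
      (weight_mono hp hp1 ((bigM_mono hk).trans hn))
  -- For j ≥ l the average is at most 1_A and the number of terms is paid by the weight at M_K; for
  -- j < l the weight at M_l suffices.
  rw [← Finset.sum_range_add_sum_Ico _ (show l ≤ K + 1 by omega), levelMajorant, add_mul,
    add_comm]
  refine add_le_add ?_ ?_
  · calc ∑ j ∈ Finset.Ico l (K + 1), average m j (ind A) x
        ≤ ∑ j ∈ Finset.Ico l (K + 1), ind A x :=
          Finset.sum_le_sum fun j hj => average_ind_le_ind (hA.mono (Finset.mem_Ico.mp hj).1) x
      _ ≤ (K + 1 : ℕ) * ind A x := by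
          rw [Finset.sum_const, Nat.card_Ico, nsmul_eq_mul]
          gcongr
          omega
      _ ≤ ENNReal.ofReal C * ENNReal.ofReal (weight p n) * ind A x := by
          gcongr
          refine le_trans ?_ (mul_le_mul_right (hw K le_rfl) _)
          rw [← ENNReal.ofReal_mul hC0, ← ENNReal.ofReal_natCast]
          refine ENNReal.ofReal_le_ofReal ?_
          push_cast
          exact hC K
      _ = _ := by ring
  · rw [Finset.sum_mul]
    refine Finset.sum_le_sum fun j _ => ?_
    calc average m j (ind A) x
        = average m j (ind A) x / ENNReal.ofReal (weight p (bigM m l))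
          * ENNReal.ofReal (weight p (bigM m l)) :=
          (ENNReal.div_mul_cancel
            (ENNReal.ofReal_pos.mpr (weight_pos p (bigM_pos l))).ne' (by simp)).symm
      _ ≤ _ := mul_le_mul_right (hw l hl) _

theorem lintegral_levelMajorant_rpow_le [∀ k, NeZero (m k)] {p : ℝ} (hp : 0 < p) (hp1 : p ≤ 1)
    (C : ℝ≥0∞) {l : ℕ} {D : ℝ≥0∞} (hD : ∑ j ∈ Finset.range l,
      ((bigM m l : ℝ≥0∞) / bigM m j) ^ (1 - p) / ENNReal.ofReal (weight p (bigM m l)) ^ p ≤ D)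
    {A : Set (Group m)} (hA : RankConst m l (· ∈ A)) :
    ∫⁻ x, levelMajorant m p C A l x ^ p ∂haar m ≤ (C ^ p + D) * haar m A := by
  have hmeas : MeasurableSet A := (filtration m).le l _ hA.measurableSet
  set w := ENNReal.ofReal (weight p (bigM m l))
  have h1 : ∀ x, levelMajorant m p C A l x ^ p ≤ C ^ p * ind A x + ∑ j ∈ Finset.range l,
      ((bigM m l : ℝ≥0∞) / bigM m j) ^ (1 - p) / w ^ p * average m j (ind A) x := by
    intro x
    refine (ENNReal.rpow_add_le_add_rpow _ _ hp.le hp1).trans (add_le_add ?_ ?_)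
    · rw [ENNReal.mul_rpow_of_nonneg _ _ hp.le]
      gcongr
      by_cases hx : x ∈ A
      · simp [ind, hx]
      · simp [ind, hx, hp]
    · refine (rpow_sum_le _ _ hp hp1).trans (Finset.sum_le_sum fun j hj => ?_)
      rw [ENNReal.div_rpow_of_nonneg _ _ hp.le, div_eq_mul_inv, div_eq_mul_inv,
        mul_right_comm]
      gcongr
      exact average_ind_rpow_le (Finset.mem_range.mp hj).le hA hp hp1 x
  have hav : ∀ j, Measurable (average m j (ind A)) := fun j => (rankConst_average j _).measurable
  refine (lintegral_mono h1).trans ?_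
  rw [lintegral_add_left ((measurable_ind hmeas).const_mul _),
    lintegral_finsetSum _ fun j _ => (hav j).const_mul _,
    lintegral_const_mul _ (measurable_ind hmeas), lintegral_ind hmeas, add_mul]
  gcongr
  refine le_trans (le_of_eq ?_) (mul_le_mul_left hD _)
  rw [Finset.sum_mul]
  refine Finset.sum_congr rfl fun j _ => ?_
  rw [lintegral_const_mul _ (hav j), lintegral_average j (measurable_ind hmeas),
    lintegral_ind hmeas]

theorem weightedMaximal_le [∀ k, NeZero (m k)] (hm : ∀ k, 2 ≤ m k) {R : ℕ} (hR : ∀ k, m k ≤ R)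
    {p : ℝ} (hp : 0 < p) (hp1 : p ≤ 1) {C : ℝ} (hC0 : 0 ≤ C)
    (hC : ∀ K : ℕ, (K : ℝ) + 1 ≤ C * weight p (bigM m K)) {f : ℕ → Group m → ℂ}
    (hf : Martingale f (filtration m) (haar m)) (x : Group m) :
    weightedMaximal m p f x ≤ ∑' k : ℤ, ∑' l : ℕ, 2 * R * 2 ^ k *
      levelMajorant m p (ENNReal.ofReal C) (firstExceedSet m f (2 ^ k) l) l x := by
  refine iSup_le fun n => ?_
  rcases eq_or_ne n 0 with rfl | hn
  · simp [partialSum]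
  obtain ⟨K, hK, hnK⟩ := exists_bigM_le_lt hm hn
  refine ENNReal.div_le_of_le_mul ((enorm_partialSum_le hm hR hf hnK x).trans ?_)
  have hmeas : ∀ (k : ℤ) (l : ℕ), Measurable fun y : Group m =>
      (2 : ℝ≥0∞) ^ (k + 1) * ind (firstExceedSet m f (2 ^ k) l) y := fun k l =>
    (measurable_ind (measurableSet_firstExceedSet f _ l)).const_mul _
  have h1 : ∀ j, average m j (fun y => ‖f (K + 1) y‖ₑ) x
      ≤ ∑' k : ℤ, ∑ l ∈ Finset.range (K + 1),
        2 ^ (k + 1) * average m j (ind (firstExceedSet m f (2 ^ k) l)) x := by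
    intro j
    refine (average_mono (fun y => enorm_le_tsum_level f K y) x).trans_eq ?_
    rw [average_tsum fun k => Finset.measurable_sum _ fun l _ => hmeas k l]
    refine tsum_congr fun k => ?_
    rw [average_finset_sum _ fun l => hmeas k l]
    refine Finset.sum_congr rfl fun l _ => ?_
    rw [average_const_mul _ (measurable_ind (measurableSet_firstExceedSet f _ l))]
  refine (mul_le_mul_right (Finset.sum_le_sum fun j _ => h1 j) _).trans ?_
  rw [← Summable.tsum_finsetSum fun _ _ => ENNReal.summable, ← ENNReal.tsum_mul_left,
    ← ENNReal.tsum_mul_right]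
  refine ENNReal.tsum_le_tsum fun k => ?_
  rw [Finset.sum_comm, Finset.mul_sum]
  -- Extending the sum over l ≤ K to all l removes the dependence on n, as the supremum requires.
  refine le_trans ?_ (mul_le_mul_left (ENNReal.sum_le_tsum (Finset.range (K + 1))) _)
  rw [Finset.sum_mul]
  refine Finset.sum_le_sum fun l hl => ?_
  rw [← Finset.mul_sum, ENNReal.zpow_add (by simp) (by simp), zpow_one, mul_assoc _ (levelMajorant _ _ _ _ _ _)]
  refine le_trans (mul_le_mul_right (mul_le_mul_right (sum_average_ind_le hp hp1 hC0 hC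
    (Nat.lt_succ_iff.mp (Finset.mem_range.mp hl)) hK (rankConst_firstExceedSet f _ l) x) _) _) ?_
  exact le_of_eq (by ring)

theorem measurable_weightedMaximal [∀ k, NeZero (m k)] (p : ℝ) (f : ℕ → Group m → ℂ) :
    Measurable (weightedMaximal m p f) :=
  Measurable.iSup fun n => (measurable_partialSum f n).enorm.div_const _

theorem measurable_levelMajorant [∀ k, NeZero (m k)] (p : ℝ) (C : ℝ≥0∞) {A : Set (Group m)}
    (hA : MeasurableSet A) (l : ℕ) : Measurable (levelMajorant m p C A l) :=
  ((measurable_ind hA).const_mul _).add <| Finset.measurable_sum _ fun j _ =>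
    (rankConst_average j _).measurable.div_const _

theorem exists_lintegral_weightedMaximal_rpow_le [∀ k, NeZero (m k)] (hm : ∀ k, 2 ≤ m k) {R : ℕ}
    (hR : ∀ k, m k ≤ R) {p : ℝ} (hp : 0 < p) (hp1 : p ≤ 1) :
    ∃ C : ℝ≥0, ∀ f : ℕ → Group m → ℂ, Martingale f (filtration m) (haar m) →
      ∫⁻ x, weightedMaximal m p f x ^ p ∂haar m
        ≤ C * ∫⁻ x, maximalFunction m f x ^ p ∂haar m := by
  obtain ⟨C, hC0, hC⟩ := exists_succ_le_mul_weight hm hp hp1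
  obtain ⟨D, hD⟩ := sum_div_weight_rpow_le hm hp hp1
  obtain ⟨E, hE⟩ := tsum_zpow_rpow_le hp
  refine ⟨(2 * R) ^ p * ((C.toNNReal ^ p + D) * R) * E, fun f hf => ?_⟩
  have hrc := rankConst_of_martingale hf
  set A := fun (k : ℤ) (l : ℕ) => firstExceedSet m f (2 ^ k) l
  have hA : ∀ k l, MeasurableSet (A k l) := fun k l => measurableSet_firstExceedSet f _ l
  have hmaj : ∀ (k : ℤ) (l : ℕ), Measurable fun x =>
      (2 * R * 2 ^ k * levelMajorant m p (ENNReal.ofReal C) (A k l) l x) ^ p := fun k l =>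
    ((measurable_levelMajorant p _ (hA k l) l).const_mul _).pow_const _
  have hstep : ∀ (k : ℤ) (l : ℕ),
      ∫⁻ x, (2 * R * 2 ^ k * levelMajorant m p (ENNReal.ofReal C) (A k l) l x) ^ p ∂haar m
        ≤ (2 * R) ^ p * (ENNReal.ofReal C ^ p + D) * (((2 : ℝ≥0∞) ^ k) ^ p * haar m (A k l)) := by
    intro k l
    simp only [ENNReal.mul_rpow_of_nonneg _ _ hp.le]
    rw [lintegral_const_mul _ ((measurable_levelMajorant p _ (hA k l) l).pow_const _)]
    refine (mul_le_mul_right (lintegral_levelMajorant_rpow_le hp hp1 _ (hD l)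
      (rankConst_firstExceedSet f _ l)) _).trans_eq ?_
    ring
  have hlevel : ∀ k : ℤ, ∑' l, haar m (A k l)
      ≤ R * ∫⁻ x, (if (2 : ℝ≥0∞) ^ k < maximalFunction m f x then 1 else 0) ∂haar m := by
    intro k
    refine (tsum_haar_firstExceedSet_le hR hrc _).trans_eq ?_
    rw [← lintegral_indicator_one
      (measurableSet_lt measurable_const (measurable_maximalFunction hrc))]
    congr 1
    exact lintegral_congr fun x => Set.indicator_apply _ _ _
  calc ∫⁻ x, weightedMaximal m p f x ^ p ∂haar m
      ≤ ∫⁻ x, ∑' k : ℤ, ∑' l : ℕ,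
          (2 * R * 2 ^ k * levelMajorant m p (ENNReal.ofReal C) (A k l) l x) ^ p ∂haar m := by
        refine lintegral_mono fun x => ?_
        refine (ENNReal.rpow_le_rpow (weightedMaximal_le hm hR hp hp1 hC0 hC hf x) hp.le).trans ?_
        refine (rpow_tsum_le _ hp hp1).trans (ENNReal.tsum_le_tsum fun k => ?_)
        exact rpow_tsum_le _ hp hp1
    _ = ∑' k : ℤ, ∑' l : ℕ, ∫⁻ x,
          (2 * R * 2 ^ k * levelMajorant m p (ENNReal.ofReal C) (A k l) l x) ^ p ∂haar m := by
        rw [lintegral_tsum fun k => (Measurable.tsum fun l => hmaj k l).aemeasurable]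
        exact tsum_congr fun k => lintegral_tsum fun l => (hmaj k l).aemeasurable
    _ ≤ ∑' k : ℤ, (2 * R) ^ p * (ENNReal.ofReal C ^ p + D) * (((2 : ℝ≥0∞) ^ k) ^ p *
          (R * ∫⁻ x, (if (2 : ℝ≥0∞) ^ k < maximalFunction m f x then 1 else 0) ∂haar m)) := by
        refine ENNReal.tsum_le_tsum fun k => (ENNReal.tsum_le_tsum fun l => hstep k l).trans ?_
        rw [ENNReal.tsum_mul_left, ENNReal.tsum_mul_left]
        gcongr
        exact hlevel k
    _ = (2 * R) ^ p * ((ENNReal.ofReal C ^ p + D) * R) * ∫⁻ x, ∑' k : ℤ,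
          ((2 : ℝ≥0∞) ^ k) ^ p * (if (2 : ℝ≥0∞) ^ k < maximalFunction m f x then 1 else 0)
          ∂haar m := by
        have hite : ∀ k : ℤ, Measurable fun x : Group m =>
            if (2 : ℝ≥0∞) ^ k < maximalFunction m f x then (1 : ℝ≥0∞) else 0 := fun k =>
          Measurable.ite (measurableSet_lt measurable_const (measurable_maximalFunction hrc))
            measurable_const measurable_const
        rw [lintegral_tsum fun k => ((hite k).const_mul _).aemeasurable, ← ENNReal.tsum_mul_left]
        refine tsum_congr fun k => ?_
        rw [lintegral_const_mul _ (hite k)]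
        ring
    _ ≤ (2 * R) ^ p * ((ENNReal.ofReal C ^ p + D) * R) *
          ∫⁻ x, E * maximalFunction m f x ^ p ∂haar m := by
        gcongr with x
        exact hE _
    _ = _ := by
        rw [lintegral_const_mul _ ((measurable_maximalFunction hrc).pow_const _)]
        push_cast
        rw [ENNReal.coe_rpow_of_nonneg _ hp.le, ENNReal.coe_rpow_of_nonneg _ hp.le]
        push_cast
        rw [ENNReal.ofReal]
        ring

theorem eLpNorm_eq_lintegral {p : ℝ} (hp : 0 < p) (u : Group m → ℝ≥0∞) :
    eLpNorm u (ENNReal.ofReal p) (haar m) = (∫⁻ x, u x ^ p ∂haar m) ^ (1 / p) := by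
  rw [eLpNorm_eq_lintegral_rpow_enorm_toReal (by simpa using hp) (by simp),
    ENNReal.toReal_ofReal hp.le]
  simp

theorem weightedMaximal_bounded [∀ k, NeZero (m k)] (hm : ∀ k, 2 ≤ m k) {R : ℕ}
    (hR : ∀ k, m k ≤ R) {p : ℝ} (hp : 0 < p) (hp1 : p ≤ 1) :
    ∃ C : ℝ≥0, ∀ f ∈ hardySpace m p,
      MemLp (weightedMaximal m p f) (ENNReal.ofReal p) (haar m) ∧
      eLpNorm (weightedMaximal m p f) (ENNReal.ofReal p) (haar m) ≤ C * hardyNorm m p f := by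
  obtain ⟨C, hC⟩ := exists_lintegral_weightedMaximal_rpow_le hm hR hp hp1
  refine ⟨C ^ (1 / p), fun f hf => ?_⟩
  have h : eLpNorm (weightedMaximal m p f) (ENNReal.ofReal p) (haar m)
      ≤ (C ^ (1 / p) : ℝ≥0) * hardyNorm m p f := by
    rw [hardyNorm, eLpNorm_eq_lintegral hp, eLpNorm_eq_lintegral hp,
      ENNReal.coe_rpow_of_nonneg _ (by positivity),
      ← ENNReal.mul_rpow_of_nonneg _ _ (by positivity)]
    exact ENNReal.rpow_le_rpow (hC f hf.1) (by positivity)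
  refine ⟨⟨(measurable_weightedMaximal p f).aestronglyMeasurable, ?_⟩, h⟩
  exact h.trans_lt (ENNReal.mul_lt_top ENNReal.coe_lt_top hf.2)

/-! ### Lacunary martingales -/

/-- The martingale difference `c_l 1_{I_l(0)} r_l`. -/
def lacunaryTerm (m : ℕ → ℕ) (c : ℕ → ℝ) (l : ℕ) (x : Group m) : ℂ :=
  (interval m l 0).indicator (fun _ => (c l : ℂ)) x * rademacher m l x

/-- The martingale with the differences `c_l 1_{I_l(0)} r_l`. -/
def lacunary (m : ℕ → ℕ) (c : ℕ → ℝ) (n : ℕ) (x : Group m) : ℂ :=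
  ∑ l ∈ Finset.range n, lacunaryTerm m c l x

theorem rankConst_indicator {α : Type*} [Zero α] {n : ℕ} {A : Set (Group m)} {h : Group m → α}
    (hA : RankConst m n (· ∈ A)) (hh : RankConst m n h) : RankConst m n (A.indicator h) := by
  intro x y hy
  by_cases hx : x ∈ A
  · rw [Set.indicator_of_mem hx, Set.indicator_of_mem ((hA x y hy).to_iff.mpr hx), hh x y hy]
  · rw [Set.indicator_of_notMem hx,
      Set.indicator_of_notMem ((hA x y hy).to_iff.not.mpr hx)]

theorem rankConst_interval (n : ℕ) (z : Group m) : RankConst m n (· ∈ interval m n z) :=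
  rankConst_of_measurableSet (MeasurableSpace.measurableSet_generateFrom ⟨z, rfl⟩)

theorem RankConst.mul {n : ℕ} {g h : Group m → ℂ} (hg : RankConst m n g) (hh : RankConst m n h) :
    RankConst m n fun x => g x * h x := fun x y hy => by
  simp only [hg x y hy, hh x y hy]

theorem rankConst_lacunaryTerm (c : ℕ → ℝ) (l : ℕ) : RankConst m (l + 1) (lacunaryTerm m c l) :=
  ((rankConst_indicator (rankConst_interval l 0) fun _ _ _ => rfl).mono (Nat.le_succ l)).mul
    (rankConst_rademacher (Nat.lt_succ_self l))

theorem rankConst_lacunary (c : ℕ → ℝ) (n : ℕ) : RankConst m n (lacunary m c n) :=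
  fun x y hy => Finset.sum_congr rfl fun l hl =>
    (rankConst_lacunaryTerm c l).mono (Nat.succ_le_of_lt (Finset.mem_range.mp hl)) x y hy

theorem enorm_lacunaryTerm [∀ k, NeZero (m k)] (c : ℕ → ℝ) (l : ℕ) (x : Group m) :
    ‖lacunaryTerm m c l x‖ₑ = ‖c l‖ₑ * ind (interval m l 0) x := by
  have h : ‖rademacher m l x‖ₑ = 1 := by
    rw [← ofReal_norm, norm_rademacher, ENNReal.ofReal_one]
  have h2 : ‖(c l : ℂ)‖ₑ = ‖c l‖ₑ := by
    rw [← ofReal_norm, ← ofReal_norm, Complex.norm_real]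
  rw [lacunaryTerm, enorm_mul, h, mul_one]
  by_cases hx : x ∈ interval m l 0
  · rw [Set.indicator_of_mem hx, ind, Set.indicator_of_mem hx, Pi.one_apply, mul_one, h2]
  · rw [Set.indicator_of_notMem hx, ind, Set.indicator_of_notMem hx, mul_zero, enorm_zero]

theorem integrable_lacunaryTerm [∀ k, NeZero (m k)] (c : ℕ → ℝ) (l : ℕ) :
    Integrable (lacunaryTerm m c l) (haar m) := by
  refine ⟨(rankConst_lacunaryTerm c l).measurable.aestronglyMeasurable, ?_⟩
  rw [HasFiniteIntegral]
  simp only [enorm_lacunaryTerm]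
  rw [lintegral_const_mul _ (measurable_ind (measurableSet_interval m l 0)),
    lintegral_ind (measurableSet_interval m l 0)]
  exact ENNReal.mul_lt_top (by simp) (measure_lt_top _ _)

theorem integrable_lacunary [∀ k, NeZero (m k)] (c : ℕ → ℝ) (n : ℕ) :
    Integrable (lacunary m c n) (haar m) :=
  integrable_finsetSum _ fun l _ => integrable_lacunaryTerm c l

theorem lacunary_succ (c : ℕ → ℝ) (n : ℕ) (x : Group m) :
    lacunary m c (n + 1) x = lacunary m c n x + lacunaryTerm m c n x :=
  Finset.sum_range_succ _ _

/-- The difference of index n is a function of rank n times r_n, hence integrates to 0 over every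
set of rank n. -/
theorem martingale_lacunary [∀ k, NeZero (m k)] (hm : ∀ k, 2 ≤ m k) (c : ℕ → ℝ) :
    Martingale (lacunary m c) (filtration m) (haar m) := by
  refine martingale_of_setIntegral_eq_succ
    (fun n => (rankConst_lacunary c n).measurable_sigmaAlg.stronglyMeasurable)
    (integrable_lacunary c) fun n s hs => ?_
  have hs' : MeasurableSet s := (filtration m).le n _ hs
  simp only [lacunary_succ]
  rw [integral_add (integrable_lacunary c n).integrableOn
    (integrable_lacunaryTerm c n).integrableOn]
  have h1 : ∫ x in s, lacunaryTerm m c n x ∂haar m = ∫ x, s.indicator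
      (fun x => (interval m n 0).indicator (fun _ => (c n : ℂ)) x) x * rademacher m n x
      ∂haar m := by
    rw [← integral_indicator hs']
    refine integral_congr_ae (Eventually.of_forall fun x => ?_)
    by_cases hx : x ∈ s
    · simp only [Set.indicator_of_mem hx, lacunaryTerm]
    · simp only [Set.indicator_of_notMem hx, zero_mul]
  rw [h1, integral_mul_rademacher hm, add_zero]
  exact rankConst_indicator (rankConst_of_measurableSet hs)
    (rankConst_indicator (rankConst_interval n 0) fun _ _ _ => rfl)

theorem maximalFunction_lacunary_le [∀ k, NeZero (m k)] (c : ℕ → ℝ) (x : Group m) :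
    maximalFunction m (lacunary m c) x ≤ ∑' l, ‖c l‖ₑ * ind (interval m l 0) x := by
  refine iSup_le fun n => ?_
  refine (enorm_sum_le _ _).trans ?_
  simp only [enorm_lacunaryTerm]
  exact ENNReal.sum_le_tsum _

/-- No cancellation is needed: the triangle inequality and subadditivity of the p-th power suffice.
-/
theorem lintegral_maximalFunction_lacunary_le [∀ k, NeZero (m k)] (c : ℕ → ℝ) {p : ℝ} (hp : 0 < p)
    (hp1 : p ≤ 1) : ∫⁻ x, maximalFunction m (lacunary m c) x ^ p ∂haar m
      ≤ ∑' l, ‖c l‖ₑ ^ p / bigM m l := by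
  have hi : ∀ l, MeasurableSet (interval m l 0) := fun l => measurableSet_interval m l 0
  calc ∫⁻ x, maximalFunction m (lacunary m c) x ^ p ∂haar m
      ≤ ∫⁻ x, ∑' l, ‖c l‖ₑ ^ p * ind (interval m l 0) x ∂haar m := by
        refine lintegral_mono fun x => ?_
        refine (ENNReal.rpow_le_rpow (maximalFunction_lacunary_le c x) hp.le).trans ?_
        refine (rpow_tsum_le _ hp hp1).trans (ENNReal.tsum_le_tsum fun l => ?_)
        rw [ENNReal.mul_rpow_of_nonneg _ _ hp.le]
        gcongr
        by_cases hx : x ∈ interval m l 0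
        · simp [ind, hx]
        · simp [ind, hx, hp]
    _ = _ := by
        rw [lintegral_tsum fun l => ((measurable_ind (hi l)).const_mul _).aemeasurable]
        refine tsum_congr fun l => ?_
        rw [lintegral_const_mul _ (measurable_ind (hi l)), lintegral_ind (hi l), haar_interval,
          div_eq_mul_inv]

/-- The Dirichlet kernel. -/
def dirichlet (m : ℕ → ℕ) (q : ℕ) (x : Group m) : ℂ := ∑ i ∈ Finset.range q, psi m i x

/-- The conjugate of r_n annihilates f_n, which has rank n; in the difference of index n it cancels
r_n, and the character of index i equals 1 on I_n(0). -/
theorem coeff_lacunary [∀ k, NeZero (m k)] (hm : ∀ k, 2 ≤ m k) (c : ℕ → ℝ) {n i : ℕ}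
    (hi : i < bigM m n) : coeff m (lacunary m c) (bigM m n + i) = c n / bigM m n := by
  have hlt : bigM m n + i < bigM m (n + 1) := by
    have := two_mul_bigM_le hm n
    omega
  have hψ : RankConst m n fun x => (starRingEnd ℂ) (psi m i x) := fun x y hy => by
    simp only [rankConst_psi hi x y hy]
  rw [coeff_eq_fourierCoeff (martingale_lacunary hm c) hlt, fourierCoeff]
  have h1 : ∀ x, lacunary m c (n + 1) x * (starRingEnd ℂ) (psi m (bigM m n + i) x)
      = lacunary m c n x * (starRingEnd ℂ) (psi m (bigM m n + i) x)
        + (interval m n 0).indicator (fun _ => (c n : ℂ)) x := by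
    intro x
    rw [lacunary_succ, add_mul]
    congr 1
    rw [psi_bigM_add hm hi, map_mul, lacunaryTerm, ← mul_assoc, mul_assoc _ (rademacher m n x),
      rademacher_mul_conj, sub_self, AddChar.map_zero_eq_one, mul_one]
    by_cases hx : x ∈ interval m n 0
    · rw [rankConst_psi hi 0 x hx, psi_zero, map_one, mul_one]
    · rw [Set.indicator_of_notMem hx, zero_mul]
  simp only [h1]
  rw [integral_add (integrable_mul_conj_psi (integrable_lacunary c n) _)
    ((integrable_const _).indicator (measurableSet_interval m n 0)),
    integral_indicator (measurableSet_interval m n 0), setIntegral_const]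
  have h2 : ∫ x, lacunary m c n x * (starRingEnd ℂ) (psi m (bigM m n + i) x) ∂haar m = 0 := by
    have h3 := integral_mul_conj_rademacher hm ((rankConst_lacunary c n).mul hψ)
    rw [← h3]
    refine integral_congr_ae (Eventually.of_forall fun x => ?_)
    simp only [psi_bigM_add hm hi, map_mul]
    ring
  rw [h2, zero_add, Measure.real, haar_interval, ENNReal.toReal_inv, ENNReal.toReal_natCast,
    Complex.real_smul, div_eq_mul_inv, mul_comm]
  push_cast
  rfl

theorem partialSum_lacunary [∀ k, NeZero (m k)] (hm : ∀ k, 2 ≤ m k) (c : ℕ → ℝ) {n q : ℕ}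
    (hq : q ≤ bigM m n) (x : Group m) :
    partialSum m (lacunary m c) (bigM m n + q) x
      = lacunary m c n x + c n / bigM m n * (rademacher m n x * dirichlet m q x) := by
  have h := partialSum_bigM hm (martingale_lacunary hm c) n x
  rw [partialSum] at h
  rw [partialSum, Finset.sum_range_add, h, dirichlet, Finset.mul_sum, Finset.mul_sum]
  congr 1
  refine Finset.sum_congr rfl fun i hi => ?_
  have hi' := (Finset.mem_range.mp hi).trans_le hq
  rw [coeff_lacunary hm c hi', psi_bigM_add hm hi']

theorem lacunary_eq_zero {c : ℕ → ℝ} (hc : c 0 = 0) {x : Group m} (hx : x 0 ≠ 0) (n : ℕ) :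
    lacunary m c n x = 0 := by
  refine Finset.sum_eq_zero fun l _ => ?_
  rcases Nat.eq_zero_or_pos l with rfl | hl
  · simp [lacunaryTerm, hc]
  · rw [lacunaryTerm, Set.indicator_of_notMem (fun h : x ∈ interval m l 0 => hx (h 0 hl)), zero_mul]

/-! ### Lebesgue constants -/

theorem dirichlet_bigM [∀ k, NeZero (m k)] (hm : ∀ k, 2 ≤ m k) (j : ℕ) (x : Group m) :
    dirichlet m (bigM m j) x = (interval m j 0).indicator (fun _ => (bigM m j : ℂ)) x := by
  classical
  have h := sum_psi_mul_conj hm j x 0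
  simp only [psi_zero, map_one, mul_one] at h
  rw [dirichlet, h, Set.indicator_apply]
  simp only [mem_interval_comm (x := x)]

theorem dirichlet_bigM_add [∀ k, NeZero (m k)] (hm : ∀ k, 2 ≤ m k) {j q : ℕ}
    (hq : q ≤ bigM m j) (x : Group m) :
    dirichlet m (bigM m j + q) x
      = (interval m j 0).indicator (fun _ => (bigM m j : ℂ)) x
        + rademacher m j x * dirichlet m q x := by
  rw [← dirichlet_bigM hm, dirichlet, Finset.sum_range_add, dirichlet, dirichlet, Finset.mul_sum]
  congr 1
  refine Finset.sum_congr rfl fun i hi => ?_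
  rw [psi_bigM_add hm ((Finset.mem_range.mp hi).trans_le hq)]

theorem norm_dirichlet_le [∀ k, NeZero (m k)] (q : ℕ) (x : Group m) : ‖dirichlet m q x‖ ≤ q := by
  refine (norm_sum_le _ _).trans ?_
  simp [norm_psi]

theorem measurable_dirichlet [∀ k, NeZero (m k)] (q : ℕ) : Measurable (dirichlet m q) :=
  Finset.measurable_sum _ fun i _ => measurable_psi i

theorem integrable_dirichlet [∀ k, NeZero (m k)] (q : ℕ) : Integrable (dirichlet m q) (haar m) :=
  Integrable.of_bound (measurable_dirichlet q).aestronglyMeasurable q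
    (Eventually.of_forall (norm_dirichlet_le q))

/-- Off I_j(0) the two kernels have equal modulus. On it the new one is at least M_j - |D_q|, and
|D_q| ≤ q. -/
theorem norm_dirichlet_bigM_add_ge [∀ k, NeZero (m k)] (hm : ∀ k, 2 ≤ m k) {j q : ℕ}
    (hq : q ≤ bigM m j) (x : Group m) :
    ‖dirichlet m q x‖ + (interval m j 0).indicator (fun _ => (bigM m j - 2 * q : ℝ)) x
      ≤ ‖dirichlet m (bigM m j + q) x‖ := by
  rw [dirichlet_bigM_add hm hq]
  have h1 : ‖rademacher m j x * dirichlet m q x‖ = ‖dirichlet m q x‖ := by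
    rw [norm_mul, norm_rademacher, one_mul]
  by_cases hx : x ∈ interval m j 0
  · rw [Set.indicator_of_mem hx, Set.indicator_of_mem hx]
    have h2 := norm_sub_norm_le (bigM m j : ℂ) (-(rademacher m j x * dirichlet m q x))
    rw [sub_neg_eq_add, norm_neg, h1, Complex.norm_natCast] at h2
    linarith [norm_dirichlet_le q x]
  · rw [Set.indicator_of_notMem hx, Set.indicator_of_notMem hx, zero_add, h1, add_zero]

/-- The numbers `M_0 + M_2 + ⋯ + M_{2k-2}`, for which the Dirichlet kernels have large norms. -/
def evenSum (m : ℕ → ℕ) (k : ℕ) : ℕ := ∑ i ∈ Finset.range k, bigM m (2 * i)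

/-- Skipping every second power gives M_{2k+2} ≥ 4 M_{2k}, so the sum stays below a third of the
next power. With all powers and m_k = 2 it would nearly reach the next power, and the gain M - 2q
below would be lost. -/
theorem three_mul_evenSum_le (hm : ∀ k, 2 ≤ m k) (k : ℕ) : 3 * evenSum m k ≤ bigM m (2 * k) := by
  induction k with
  | zero => simp [evenSum]
  | succ k ih =>
    have h1 := two_mul_bigM_le hm (2 * k)
    have h2 := two_mul_bigM_le hm (2 * k + 1)
    rw [evenSum, Finset.sum_range_succ, ← evenSum]
    rw [show 2 * (k + 1) = 2 * k + 1 + 1 by ring]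
    omega

theorem evenSum_half_le [∀ k, NeZero (m k)] (hm : ∀ k, 2 ≤ m k) (n : ℕ) :
    evenSum m (n / 2) ≤ bigM m n := by
  have h1 := three_mul_evenSum_le hm (n / 2)
  have h2 := bigM_mono (m := m) (Nat.mul_div_le n 2)
  omega

/-- Each new summand contributes at least (M_{2k} - 2q)/M_{2k} ≥ 1/3, with q the previous sum. -/
theorem le_integral_norm_dirichlet [∀ k, NeZero (m k)] (hm : ∀ k, 2 ≤ m k) (k : ℕ) :
    (k : ℝ) / 3 ≤ ∫ x, ‖dirichlet m (evenSum m k) x‖ ∂haar m := by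
  induction k with
  | zero => simpa using integral_nonneg fun x => norm_nonneg _
  | succ k ih =>
    have h3 := three_mul_evenSum_le hm k
    have h3' : 3 * (evenSum m k : ℝ) ≤ bigM m (2 * k) := by exact_mod_cast h3
    have hM : (0 : ℝ) < bigM m (2 * k) := Nat.cast_pos.mpr (bigM_pos _)
    have hs : evenSum m (k + 1) = bigM m (2 * k) + evenSum m k := by
      rw [evenSum, Finset.sum_range_succ, ← evenSum, add_comm]
    have hint : Integrable ((interval m (2 * k) 0).indicator
        (fun _ => (bigM m (2 * k) - 2 * evenSum m k : ℝ))) (haar m) :=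
      (integrable_const _).indicator (measurableSet_interval m _ 0)
    have h4 := integral_mono ((integrable_dirichlet (m := m) (evenSum m k)).norm.add hint)
      (integrable_dirichlet (bigM m (2 * k) + evenSum m k)).norm
      (norm_dirichlet_bigM_add_ge hm (q := evenSum m k) (by omega))
    simp only [Pi.add_apply] at h4
    rw [integral_add (integrable_dirichlet (m := m) (evenSum m k)).norm hint,
      integral_indicator (measurableSet_interval m _ 0), setIntegral_const, Measure.real,
      haar_interval, ENNReal.toReal_inv, ENNReal.toReal_natCast, smul_eq_mul] at h4
    rw [hs]
    have h5 : (1 : ℝ) / 3 ≤ (bigM m (2 * k) : ℝ)⁻¹ * (bigM m (2 * k) - 2 * evenSum m k) := by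
      rw [inv_mul_eq_div, le_div_iff₀ hM]
      linarith
    push_cast
    linarith

theorem ofReal_le_lintegral_dirichlet [∀ k, NeZero (m k)] (hm : ∀ k, 2 ≤ m k) (k : ℕ) :
    ENNReal.ofReal (k / 3) ≤ ∫⁻ x, ‖dirichlet m (evenSum m k) x‖ₑ ∂haar m := by
  rw [← ofReal_integral_norm_eq_lintegral_enorm (integrable_dirichlet _)]
  exact ENNReal.ofReal_le_ofReal (le_integral_norm_dirichlet hm k)

/-! ### Selection of the coefficients -/

/-- Put 2^{-k} at an index a_k with G(a_k) ≥ k 2^{ks}, and 0 elsewhere. Requiring a_k > 0 gives ε_0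
= 0, which makes the martingale vanish off I_1(0). -/
theorem exists_sparse_coefficients {G : ℕ → ℝ} (hG : ∀ B, ∃ᶠ n in atTop, B ≤ G n) (s : ℝ) :
    ∃ ε : ℕ → ℝ, (∀ n, 0 ≤ ε n) ∧ ε 0 = 0 ∧ Summable ε ∧
      ∀ B, ∃ n, B ≤ ε n ^ s * G n := by
  have h : ∀ k : ℕ, ∃ᶠ n in atTop, 0 < n ∧ (k : ℝ) * ((2 : ℝ) ^ k) ^ s ≤ G n := fun k =>
    ((hG _).and_eventually (eventually_gt_atTop 0)).mono fun n hn => ⟨hn.2, hn.1⟩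
  obtain ⟨a, ha, haG⟩ := extraction_forall_of_frequently h
  refine ⟨Function.extend a (fun k => (1 / 2 : ℝ) ^ k) 0, fun n => ?_, ?_, ?_, fun B => ?_⟩
  · by_cases hn : ∃ k, a k = n
    · obtain ⟨k, rfl⟩ := hn
      rw [ha.injective.extend_apply]
      positivity
    · rw [Function.extend_apply' _ _ _ hn, Pi.zero_apply]
  · rw [Function.extend_apply' _ _ _ fun ⟨k, hk⟩ => (haG k).1.ne' hk, Pi.zero_apply]
  · exact (summable_extend_zero ha.injective).mpr summable_geometric_two
  · obtain ⟨k, hk⟩ := exists_nat_ge B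
    refine ⟨a k, hk.trans ?_⟩
    rw [ha.injective.extend_apply, one_div, inv_pow, Real.inv_rpow (by positivity)]
    have h2 : (0 : ℝ) < ((2 : ℝ) ^ k) ^ s := by positivity
    rw [inv_mul_eq_div, le_div_iff₀ h2]
    exact (haG k).2

/-- Transfers unboundedness of weight/φ to the indices N_k. If M_{k+1} ≤ n < M_{k+2}, then N_k ≤ n
gives φ(N_k) ≤ φ(n), while the weight at n is at most that at M_{k+2}, hence at most C W_k. -/
theorem frequently_le_div [∀ k, NeZero (m k)] (hm : ∀ k, 2 ≤ m k) {p : ℝ} (hp : 0 < p)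
    (hp1 : p ≤ 1) {φ : ℕ+ → ℝ} (hφ : ∀ n, 1 ≤ φ n) (hmono : Monotone φ)
    (hlim : limsup (fun n : ℕ+ => ((weight p n / φ n : ℝ) : EReal)) atTop = ⊤)
    {W : ℕ → ℝ} {C : ℝ} (hC : 0 < C) (hW : ∀ n, 2 ≤ n → weight p (bigM m (n + 2)) ≤ C * W n)
    {N : ℕ → ℕ+} (hN : ∀ n, (N n : ℕ) ≤ bigM m (n + 1)) (B : ℝ) :
    ∃ᶠ n in atTop, B ≤ W n / φ (N n) := by
  rw [frequently_atTop]
  intro n₀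
  have h1 : ∃ᶠ n : ℕ+ in atTop, ((C * B : ℝ) : EReal) < ((weight p n / φ n : ℝ) : EReal) :=
    frequently_lt_of_lt_limsup (by isBoundedDefault) (by rw [hlim]; exact EReal.coe_lt_top _)
  -- Starting at M_{n₀+4} guarantees k ≥ n₀ and k ≥ 2, the latter being needed for `hW`.
  obtain ⟨n, hn, hB⟩ := frequently_atTop.mp h1 ⟨bigM m (n₀ + 4), bigM_pos _⟩
  have hn' : bigM m (n₀ + 4) ≤ n := hn
  rw [EReal.coe_lt_coe_iff] at hB
  obtain ⟨K, hK1, hK2⟩ := exists_bigM_le_lt hm n.pos.ne'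
  have hK : n₀ + 3 < K + 1 := by
    by_contra h
    exact absurd (hn'.trans_lt hK2) (not_lt.mpr (bigM_mono (by omega)))
  obtain ⟨k, rfl⟩ : ∃ k, K = k + 1 := ⟨K - 1, by omega⟩
  refine ⟨k, by omega, ?_⟩
  have hle : φ (N k) ≤ φ n := hmono (PNat.coe_le_coe _ _ |>.mp ((hN k).trans hK1))
  have hw : weight p n ≤ C * W k := (weight_mono hp hp1 hK2.le).trans (hW k (by omega))
  have hpos : 0 < φ (N k) := one_pos.trans_le (hφ _)
  have hw0 : 0 < weight p n := weight_pos p n.pos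
  have hW0 : 0 ≤ W k := by
    by_contra h
    nlinarith
  have h2 : C * B < C * (W k / φ (N k)) := by
    refine hB.trans_le ?_
    rw [← mul_div_assoc]
    exact div_le_div₀ (mul_nonneg hC.le hW0) hw hpos hle
  exact (lt_of_mul_lt_mul_left h2 hC.le).le

/-! ### Divergence -/

/-- The coefficients `(ε_l M_l) ^ {1/p}`. -/
def hardyCoeff (m : ℕ → ℕ) (p : ℝ) (ε : ℕ → ℝ) (l : ℕ) : ℝ := (ε l * bigM m l) ^ (1 / p)

theorem hardyCoeff_div_bigM [∀ k, NeZero (m k)] (p : ℝ) {ε : ℕ → ℝ} (hε : ∀ n, 0 ≤ ε n) (l : ℕ) :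
    hardyCoeff m p ε l / bigM m l = ε l ^ (1 / p) * (bigM m l : ℝ) ^ (1 / p - 1) := by
  have hM : (0 : ℝ) < bigM m l := Nat.cast_pos.mpr (bigM_pos l)
  rw [hardyCoeff, Real.mul_rpow (hε l) hM.le, Real.rpow_sub_one hM.ne', mul_div_assoc]

/-- The exponent in `hardyCoeff` is chosen so that c_l^p μ(I_l(0)) = ε_l. -/
theorem lacunary_mem_hardySpace [∀ k, NeZero (m k)] (hm : ∀ k, 2 ≤ m k) {p : ℝ} (hp : 0 < p)
    (hp1 : p ≤ 1) {ε : ℕ → ℝ} (hε : ∀ n, 0 ≤ ε n) (hsum : Summable ε) :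
    lacunary m (hardyCoeff m p ε) ∈ hardySpace m p := by
  refine ⟨martingale_lacunary hm _, ?_⟩
  rw [hardyNorm, eLpNorm_eq_lintegral hp]
  refine ENNReal.rpow_lt_top_of_nonneg (by positivity) ?_
  refine ((lintegral_maximalFunction_lacunary_le _ hp hp1).trans_lt ?_).ne
  have h : ∀ l, ‖hardyCoeff m p ε l‖ₑ ^ p / bigM m l = ENNReal.ofReal (ε l) := by
    intro l
    have h0 : 0 ≤ ε l * bigM m l := mul_nonneg (hε l) (Nat.cast_nonneg _)
    rw [hardyCoeff, Real.enorm_eq_ofReal (Real.rpow_nonneg h0 _),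
      ENNReal.ofReal_rpow_of_nonneg (Real.rpow_nonneg h0 _) hp.le, ← Real.rpow_mul h0,
      one_div_mul_cancel hp.ne', Real.rpow_one, ENNReal.ofReal_mul (hε l), ENNReal.ofReal_natCast,
      ENNReal.mul_div_cancel_right (by simp [(bigM_pos l).ne']) (by simp)]
  simp only [h]
  exact hsum.tsum_ofReal_lt_top

theorem exists_unbounded_weakLpNorm [∀ k, NeZero (m k)] (hm : ∀ k, 2 ≤ m k) {R : ℕ}
    (hR : ∀ k, m k ≤ R) {p : ℝ} (hp : 0 < p) (hp1 : p < 1) {φ : ℕ+ → ℝ} (hφ : ∀ n, 1 ≤ φ n)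
    (hmono : Monotone φ)
    (hlim : limsup (fun n : ℕ+ => ((weight p n / φ n : ℝ) : EReal)) atTop = ⊤) :
    ∃ f ∈ hardySpace m p,
      (⨆ n : ℕ+, weakLpNorm m p (fun x => partialSum m f n x / (φ n : ℂ))) = ∞ := by
  -- One character beyond M_n: it adds a term of constant modulus to f_n, and f_n vanishes off
  -- I_1(0).
  set N : ℕ → ℕ+ := fun n => ⟨bigM m n + 1, Nat.succ_pos _⟩
  have hN : ∀ n, (N n : ℕ) ≤ bigM m (n + 1) := fun n => by
    have h1 := two_mul_bigM_le hm n
    have h2 := bigM_pos (m := m) n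
    change bigM m n + 1 ≤ _
    omega
  have hs : 0 < 1 / p - 1 := sub_pos.mpr ((one_lt_div hp).mpr hp1)
  have hR0 : (0 : ℝ) < R := Nat.cast_pos.mpr (lt_of_lt_of_le (by omega) ((hm 0).trans (hR 0)))
  have hW : ∀ n, 2 ≤ n → weight p (bigM m (n + 2))
      ≤ (2 * (R : ℝ) ^ 2) ^ (1 / p - 1) * (bigM m n : ℝ) ^ (1 / p - 1) := by
    intro n _
    rw [weight_of_lt_one hp1, ← Real.mul_rpow (by positivity) (by positivity)]
    refine Real.rpow_le_rpow (by positivity) ?_ hs.le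
    have h1 : bigM m (n + 2) + 1 ≤ 2 * R ^ 2 * bigM m n := by
      have h2 : bigM m (n + 2) ≤ R ^ 2 * bigM m n := by
        calc m (n + 1) * (m n * bigM m n) ≤ R * (R * bigM m n) := by
              gcongr <;> exact hR _
          _ = _ := by ring
      have h3 := bigM_pos (m := m) (n + 2)
      nlinarith
    exact_mod_cast h1
  obtain ⟨ε, hε0, hε1, hsum, hε⟩ := exists_sparse_coefficients
    (frequently_le_div hm hp hp1.le hφ hmono hlim (by positivity) hW hN) (1 / p)
  refine ⟨_, lacunary_mem_hardySpace hm hp hp1.le hε0 hsum, ?_⟩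
  refine ENNReal.eq_top_of_forall_nnreal_le fun r => ?_
  -- The set found below has measure at least 1/2, and t (1/2)^{1/p} = r + 1.
  set t : ℝ≥0 := (r + 1) * 2 ^ (1 / p)
  obtain ⟨n, hn⟩ := hε (t + 1)
  refine le_trans ?_ (le_iSup _ (N n))
  have ht : 0 < t := by positivity
  refine le_trans ?_ (le_iSup₂ (α := ℝ≥0∞) t ht)
  have hc0 : hardyCoeff m p ε 0 = 0 := by
    rw [hardyCoeff, hε1, zero_mul, Real.zero_rpow (by positivity)]
  have hsub : (interval m 1 0)ᶜ ⊆ {x | (t : ℝ≥0∞) <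
      ‖partialSum m (lacunary m (hardyCoeff m p ε)) (N n) x / (φ (N n) : ℂ)‖ₑ} := by
    intro x hx
    have hx0 : x 0 ≠ 0 := fun h => hx fun k hk => by
      obtain rfl : k = 0 := by omega
      exact h
    have h1 : partialSum m (lacunary m (hardyCoeff m p ε)) (N n) x / (φ (N n) : ℂ)
        = ((ε n ^ (1 / p) * ((bigM m n : ℝ) ^ (1 / p - 1) / φ (N n)) : ℝ) : ℂ)
          * rademacher m n x := by
      change partialSum m _ (bigM m n + 1) x / _ = _
      rw [partialSum_lacunary hm _ (bigM_pos n), lacunary_eq_zero hc0 hx0, zero_add,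
        ← mul_div_assoc, ← hardyCoeff_div_bigM p hε0]
      simp [dirichlet, psi]
      ring
    change (t : ℝ≥0∞) < ‖_‖ₑ
    rw [h1, ← ofReal_norm, norm_mul, norm_rademacher, mul_one, Complex.norm_real, Real.norm_eq_abs,
      ENNReal.lt_ofReal_iff_toReal_lt ENNReal.coe_ne_top, ENNReal.coe_toReal]
    exact lt_of_lt_of_le (by linarith) (le_abs_self _)
  have hhalf : (2 : ℝ≥0∞)⁻¹ ≤ haar m (interval m 1 0)ᶜ := by
    rw [prob_compl_eq_one_sub (measurableSet_interval m 1 0), haar_interval,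
      ← ENNReal.one_sub_inv_two]
    refine tsub_le_tsub_left (ENNReal.inv_le_inv.mpr ?_) 1
    have := two_pow_le_bigM hm 1
    exact_mod_cast this
  calc (r : ℝ≥0∞) ≤ (r + 1) * ((2 : ℝ≥0∞) ^ (1 / p) * (2 : ℝ≥0∞)⁻¹ ^ (1 / p)) := by
        rw [← ENNReal.mul_rpow_of_nonneg _ _ (by positivity),
          ENNReal.mul_inv_cancel (by simp) (by simp), ENNReal.one_rpow, mul_one]
        exact le_self_add
    _ = t * (2 : ℝ≥0∞)⁻¹ ^ (1 / p) := by
        rw [← mul_assoc]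
        congr 1
        simp only [t]
        push_cast
        rw [ENNReal.coe_rpow_of_nonneg _ (by positivity)]
        rfl
    _ ≤ _ := by
        gcongr
        exact hhalf.trans (measure_mono hsub)

theorem exists_unbounded_eLpNorm [∀ k, NeZero (m k)] (hm : ∀ k, 2 ≤ m k) {R : ℕ}
    (hR : ∀ k, m k ≤ R) {φ : ℕ+ → ℝ} (hφ : ∀ n, 1 ≤ φ n) (hmono : Monotone φ)
    (hlim : limsup (fun n : ℕ+ => ((weight 1 n / φ n : ℝ) : EReal)) atTop = ⊤) :
    ∃ f ∈ hardySpace m 1,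
      (⨆ n : ℕ+, eLpNorm (fun x => partialSum m f n x / (φ n : ℂ)) 1 (haar m)) = ∞ := by
  -- ⌊n/2⌋ summands keep the increment at most M_n, while its Lebesgue constant is at least ⌊n/2⌋/3.
  set N : ℕ → ℕ+ := fun n => ⟨bigM m n + evenSum m (n / 2), Nat.add_pos_left (bigM_pos n) _⟩
  have hN : ∀ n, (N n : ℕ) ≤ bigM m (n + 1) := fun n => by
    have h1 := two_mul_bigM_le hm n
    have h2 := evenSum_half_le hm n
    change bigM m n + evenSum m (n / 2) ≤ _
    omega
  have hR2 : 2 ≤ R := (hm 0).trans (hR 0)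
  have hlogR : 0 < Real.log R := Real.log_pos (by exact_mod_cast hR2)
  -- M_{n+2} + 1 ≤ R^{n+3}, and n + 3 ≤ 6⌊n/2⌋ for n ≥ 2.
  have hW : ∀ n, 2 ≤ n → weight 1 (bigM m (n + 2)) ≤ 6 * Real.log R * ((n / 2 : ℕ) : ℝ) := by
    intro n hn
    have h1 : bigM m (n + 2) + 1 ≤ R ^ (n + 3) := by
      have h2 := bigM_le_pow hR (n + 2)
      have h3 := bigM_pos (m := m) (n + 2)
      rw [pow_succ]
      nlinarith
    have h2 : Real.log (bigM m (n + 2) + 1) ≤ (n + 3 : ℕ) * Real.log R := by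
      rw [← Real.log_pow]
      exact Real.log_le_log (by positivity) (by exact_mod_cast h1)
    have h3 : ((n + 3 : ℕ) : ℝ) ≤ 6 * ((n / 2 : ℕ) : ℝ) := by
      have : n + 3 ≤ 6 * (n / 2) := by omega
      exact_mod_cast this
    rw [weight_one]
    nlinarith
  obtain ⟨ε, hε0, hε1, hsum, hε⟩ := exists_sparse_coefficients
    (frequently_le_div hm one_pos le_rfl hφ hmono hlim (by positivity) hW hN) 1
  set f := lacunary m (hardyCoeff m 1 ε)
  have hf : f ∈ hardySpace m 1 := lacunary_mem_hardySpace hm one_pos le_rfl hε0 hsum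
  refine ⟨f, hf, ?_⟩
  set H := ∫⁻ x, maximalFunction m f x ∂haar m
  have hH : H ≠ ∞ := by
    have h1 := hf.2.ne
    rw [hardyNorm, eLpNorm_eq_lintegral one_pos] at h1
    simpa using h1
  refine ENNReal.eq_top_of_forall_nnreal_le fun r => ?_
  -- The factor 3 undoes the 1/3 of the Lebesgue constant; H = ∫ f^* is reserved for the term f_n/φ,
  -- which is dominated by f^* because φ ≥ 1.
  obtain ⟨n, hn⟩ := hε (3 * (r + H.toReal))
  refine le_trans ?_ (le_iSup _ (N n))
  rw [eLpNorm_one_eq_lintegral_enorm]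
  have hpos : 0 < φ (N n) := one_pos.trans_le (hφ _)
  have hc : 0 ≤ ε n / φ (N n) := div_nonneg (hε0 n) hpos.le
  have hpt : ∀ x, ENNReal.ofReal (ε n / φ (N n)) * ‖dirichlet m (evenSum m (n / 2)) x‖ₑ
      ≤ ‖partialSum m f (N n) x / (φ (N n) : ℂ)‖ₑ + maximalFunction m f x := by
    intro x
    have h1 : ((ε n / φ (N n) : ℝ) : ℂ) * (rademacher m n x * dirichlet m (evenSum m (n / 2)) x)
        = partialSum m f (N n) x / (φ (N n) : ℂ) - f n x / (φ (N n) : ℂ) := by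
      change _ = partialSum m f (bigM m n + evenSum m (n / 2)) x / _ - _
      have h2 : ((hardyCoeff m 1 ε n : ℂ) / bigM m n) = (ε n : ℂ) := by
        have := hardyCoeff_div_bigM (m := m) 1 hε0 n
        simp only [div_one, Real.rpow_one, sub_self, Real.rpow_zero, mul_one] at this
        rw [← this]
        push_cast
        rfl
      rw [partialSum_lacunary hm _ (evenSum_half_le hm n), h2, ← sub_div, add_sub_cancel_left]
      push_cast
      ring
    have h3 : ‖((ε n / φ (N n) : ℝ) : ℂ) *
        (rademacher m n x * dirichlet m (evenSum m (n / 2)) x)‖ₑ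
        = ENNReal.ofReal (ε n / φ (N n)) * ‖dirichlet m (evenSum m (n / 2)) x‖ₑ := by
      rw [← ofReal_norm, ← ofReal_norm, norm_mul, norm_mul, norm_rademacher, one_mul,
        Complex.norm_real, Real.norm_of_nonneg hc, ENNReal.ofReal_mul hc]
    rw [← h3, h1]
    refine enorm_sub_le.trans (add_le_add le_rfl ?_)
    refine le_trans ?_ (le_iSup (fun k => ‖f k x‖ₑ) n)
    rw [← ofReal_norm, ← ofReal_norm, norm_div, Complex.norm_real, Real.norm_of_nonneg hpos.le]
    exact ENNReal.ofReal_le_ofReal (div_le_self (norm_nonneg _) (hφ _))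
  have hint := lintegral_mono (μ := haar m) hpt
  rw [lintegral_const_mul _ (measurable_dirichlet _).enorm, lintegral_add_right _
    (measurable_maximalFunction (rankConst_lacunary _))] at hint
  have h4 : (r : ℝ≥0∞) + H ≤ ENNReal.ofReal (ε n / φ (N n)) *
      ∫⁻ x, ‖dirichlet m (evenSum m (n / 2)) x‖ₑ ∂haar m := by
    refine le_trans ?_ (mul_le_mul_right (ofReal_le_lintegral_dirichlet hm (n / 2)) _)
    rw [← ENNReal.ofReal_mul hc, ← ENNReal.ofReal_toReal hH, ← ENNReal.ofReal_coe_nnreal,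
      ← ENNReal.ofReal_add r.coe_nonneg ENNReal.toReal_nonneg]
    refine ENNReal.ofReal_le_ofReal ?_
    rw [Real.rpow_one] at hn
    calc (r : ℝ) + H.toReal ≤ ε n * (((n / 2 : ℕ) : ℝ) / φ (N n)) / 3 := by linarith
      _ = _ := by ring
  exact (ENNReal.add_le_add_iff_right hH).mp (h4.trans hint)

end Vilenkin

end

theorem theorem1 (m : ℕ → ℕ) (hm : ∀ k, 2 ≤ m k) (hbdd : BddAbove (Set.range m)) :
    (∀ p : ℝ, 0 < p → p ≤ 1 →
      ∃ C : ℝ≥0, ∀ f ∈ Vilenkin.hardySpace m p,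
        MemLp (Vilenkin.weightedMaximal m p f) (ENNReal.ofReal p) (Vilenkin.haar m) ∧
        eLpNorm (Vilenkin.weightedMaximal m p f) (ENNReal.ofReal p) (Vilenkin.haar m)
          ≤ C * Vilenkin.hardyNorm m p f) ∧
    (∀ p : ℝ, 0 < p → p ≤ 1 → ∀ φ : ℕ+ → ℝ, (∀ n, 1 ≤ φ n) → Monotone φ →
      limsup (fun n : ℕ+ => ((Vilenkin.weight p n / φ n : ℝ) : EReal)) atTop = ⊤ →
      (p < 1 → ∃ f ∈ Vilenkin.hardySpace m p,
        (⨆ n : ℕ+, Vilenkin.weakLpNorm m p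
          (fun x => Vilenkin.partialSum m f n x / (φ n : ℂ))) = ∞) ∧
      (p = 1 → ∃ f ∈ Vilenkin.hardySpace m 1,
        (⨆ n : ℕ+, eLpNorm
          (fun x => Vilenkin.partialSum m f n x / (φ n : ℂ)) 1 (Vilenkin.haar m)) = ∞)) := by
  have : ∀ k, NeZero (m k) := fun k => ⟨by have := hm k; omega⟩
  obtain ⟨R, hR⟩ := hbdd
  have hR' : ∀ k, m k ≤ R := fun k => hR ⟨k, rfl⟩
  refine ⟨fun p hp hp1 => Vilenkin.weightedMaximal_bounded hm hR' hp hp1,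
    fun p hp _ φ hφ hmono hlim => ⟨fun hp1 => ?_, fun hp1 => ?_⟩⟩
  · exact Vilenkin.exists_unbounded_weakLpNorm hm hR' hp hp1 hφ hmono hlim
  · subst hp1
    exact Vilenkin.exists_unbounded_eLpNorm hm hR' hφ hmono hlim
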